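/- Let $\mathbb{K}$ be an algebraically closed field of characteristic $0$ and let $p\ge 1$ be an integer. Let $2Nilp_{2p}$ be the affine variety of all skew-symmetric bilinear maps $\mu$ on $\mathbb{K}^{2p}$ with $\mu(\mu(x,y),z)=0$ for all $x,y,z$ (the $2$-step nilpotent Lie brackets, the abelian one included), with the Zariski topology given by the structure constants. The characteristic sequence of $\mu$ is the lexicographically largest among the decreasing sequences of the sizes of the Jordan blocks of the operators $\mathrm{ad}(x)=\mu(x,\cdot)$ with $x\notin[\mathfrak g,\mathfrak g]$, where $\mathfrak g=(\mathbb{K}^{2p},\mu)$. Let $\mathcal{F}=\mathcal{F}^{2p,2}_{p-1,2}\subset 2Nilp_{2p}$ be the set of those $\mu$ whose characteristic sequence is $(2,\dots,2,1,1)$, with $p-1$ entries equal to $2$. Let $X_1,\dots,X_{2p}$ be the standard basis of $\mathbb{K}^{2p}$, and let $\mu_0$ be the bracket of $\mathfrak{g}_{p-1,2}$, that is, $\mu_0(X_1,X_{2i})=X_{2i+1}$ for $1\le i\le p-1$, the undefined brackets being zero. Consider the two linear families of skew-symmetric bilinear maps $\varphi$ given, with arbitrary coefficients, by $$(C_1)\qquad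 \varphi(X_{2i},X_{2j})=\sum_{k=1}^{p-1}a_{2i,2j}^{2k+1}X_{2k+1},\qquad 1\le i<j\le p,$$ $$(C_2)\qquad \varphi(X_{2i},X_{2j})=\sum_{k=1}^{p-1}a_{2i,2j}^{2k+1}X_{2k+1}+a_{2i,2j}^{2p}X_{2p},\qquad 1\le i<j\le p-1,$$ where in each family the undefined products $\varphi(X_a,X_b)$ are zero. For $m=1,2$ let $\mathcal{C}_m$ be the set of all brackets on $\mathbb{K}^{2p}$ that are isomorphic to $\mu_0+\varphi$ for some $\varphi$ in the family $(C_m)$. Then: 1. Every $\varphi$ in the families $(C_1)$ and $(C_2)$ is a $2$-cocycle of $\mathfrak{g}_{p-1,2}$, i.e. $\mu_0(x,\varphi(y,z))+\varphi(x,\mu_0(y,z))=0$ for all $x,y,z$. 2. $\mathcal{F}$ is Zariski-open in $2Nilp_{2p}$, and $\mathcal{F}=\mathcal{C}_1\cup\mathcal{C}_2$. 3. The irreducible components of the variety $\mathcal{F}$ are exactly $\mathcal{C}_1$ and $\mathcal{C}_2$. 4. These two components are different if and only if $p\ge 3$ (for $p=1,2$ they coincide and $\mathcal{F}$ is irreducible).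 -/

import Mathlib

namespace TwoNilpotent

/-- Bilinear products on `K ^ n`, identified with `K ^ (n ^ 3)` through their structure constants. -/
abbrev Bracket (K : Type*) [Field K] (n : ℕ) : Type _ :=
  (Fin n → K) →ₗ[K] (Fin n → K) →ₗ[K] (Fin n → K)

/-- The structure constants `C i j k` of a product: `μ (e i) (e j) = ∑ k, C i j k • e k`. -/
def structConst {K : Type*} [Field K] {n : ℕ} (μ : Bracket K n) : Fin n × Fin n × Fin n → K :=
  fun t => μ (Pi.single t.1 1) (Pi.single t.2.1 1) t.2.2

/-- The Zariski topology on the affine space of products: the sets on which a polynomial in the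
structure constants does not vanish form a basis of open sets. -/
instance zariskiTopology (K : Type*) [Field K] (n : ℕ) : TopologicalSpace (Bracket K n) :=
  TopologicalSpace.generateFrom
    {U | ∃ f : MvPolynomial (Fin n × Fin n × Fin n) K,
      U = {μ : Bracket K n | MvPolynomial.eval (structConst μ) f ≠ 0}}

/-- The variety of `2`-step nilpotent Lie brackets on `K ^ n` (abelian brackets included): the
skew-symmetric products with `[[x, y], z] = 0`; the Jacobi identity follows. -/
def twoNilp (K : Type*) [Field K] (n : ℕ) : Set (Bracket K n) :=
  {μ | (∀ x, μ x x = 0) ∧ ∀ x y z, μ (μ x y) z = 0}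

/-- The derived ideal `[g, g]`. -/
def derivedIdeal {K : Type*} [Field K] {n : ℕ} (μ : Bracket K n) : Submodule K (Fin n → K) :=
  Submodule.span K {z | ∃ x y, z = μ x y}

/-- `s` is the decreasing sequence of the sizes of the Jordan blocks of the nilpotent
endomorphism `N`. -/
def IsJordanType {K V : Type*} [Field K] [AddCommGroup V] [Module K V]
    (N : Module.End K V) (s : List ℕ) : Prop :=
  s.Pairwise (fun a b => b ≤ a) ∧ (∀ d ∈ s, 0 < d) ∧
    ∃ b : Module.Basis (Σ i : Fin s.length, Fin (s.get i)) K V,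
      ∀ (i : Fin s.length) (j : Fin (s.get i)),
        N (b ⟨i, j⟩) = if h : j.val + 1 < s.get i then b ⟨i, ⟨j.val + 1, h⟩⟩ else 0

/-- `s` is the characteristic sequence of the nilpotent Lie algebra `(K ^ n, μ)`: the
lexicographically largest Jordan type of an operator `ad x` with `x` outside `[g, g]`. -/
def HasCharacteristicSequence {K : Type*} [Field K] {n : ℕ} (μ : Bracket K n) (s : List ℕ) : Prop :=
  IsGreatest {c : List ℕ | ∃ x, x ∉ derivedIdeal μ ∧ IsJordanType (μ x) c} s

/-- The family of `2p`-dimensional `2`-step nilpotent Lie algebras with characteristic sequence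
`(2, …, 2, 1, 1)`, where `2` occurs `p - 1` times. -/
def family (K : Type*) [Field K] (p : ℕ) : Set (Bracket K (2 * p)) :=
  {μ | μ ∈ twoNilp K (2 * p) ∧ HasCharacteristicSequence μ (List.replicate (p - 1) 2 ++ [1, 1])}

/-- The basis vectors `X 1, …, X n` of `K ^ n`, numbered from `1`. -/
def X (K : Type*) [Field K] (n k : ℕ) : Fin n → K :=
  fun i => if i.val + 1 = k then 1 else 0

/-- The skew-symmetric product with `[X a, X b] = v = -[X b, X a]` for `a ≠ b`, all other products
of basis vectors being zero. -/
def elementary (K : Type*) [Field K] (n a b : ℕ) (v : Fin n → K) : Bracket K n :=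
  LinearMap.mk₂ K
    (fun x y => ((X K n a ⬝ᵥ x) * (X K n b ⬝ᵥ y) - (X K n b ⬝ᵥ x) * (X K n a ⬝ᵥ y)) • v)
    (by intro x x' y; simp only [dotProduct_add, ← add_smul]; congr 1; ring)
    (by intro c x y; simp only [dotProduct_smul, smul_eq_mul, smul_smul]; congr 1; ring)
    (by intro x y y'; simp only [dotProduct_add, ← add_smul]; congr 1; ring)
    (by intro c x y; simp only [dotProduct_smul, smul_eq_mul, smul_smul]; congr 1; ring)

/-- The bracket of `g_{p-1,2}`: `[X 1, X (2 i)] = X (2 i + 1)` for `1 ≤ i ≤ p - 1`. -/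
def baseBracket (K : Type*) [Field K] (p : ℕ) : Bracket K (2 * p) :=
  ∑ i ∈ Finset.Icc 1 (p - 1), elementary K (2 * p) 1 (2 * i) (X K (2 * p) (2 * i + 1))

/-- The space of `2`-cocycles of the CH-cohomology of a `2`-step nilpotent bracket `μ` with
coefficients in the algebra itself. -/
def cocycles {K : Type*} [Field K] {n : ℕ} (μ : Bracket K n) : Set (Bracket K n) :=
  {φ | (∀ x, φ x x = 0) ∧ ∀ x y z, μ x (φ y z) + φ x (μ y z) = 0}

/-- The span of the vectors `X (2 k + 1)`, `1 ≤ k ≤ p - 1`. -/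
def oddSpan (K : Type*) [Field K] (p : ℕ) : Submodule K (Fin (2 * p) → K) :=
  Submodule.span K {v | ∃ k, 1 ≤ k ∧ k ≤ p - 1 ∧ v = X K (2 * p) (2 * k + 1)}

/-- The linear family of skew-symmetric maps with
`φ (X (2 i), X (2 j)) = ∑ k ∈ [1, p - 1], a i j k • X (2 k + 1)` for `1 ≤ i < j ≤ p`, the products
of basis vectors that are not determined by this being zero. -/
def cocycleFamily₁ (K : Type*) [Field K] (p : ℕ) : Submodule K (Bracket K (2 * p)) where
  carrier := {φ | (∀ x, φ x x = 0) ∧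
    (∀ i j, 1 ≤ i → i < j → j ≤ p →
      φ (X K (2 * p) (2 * i)) (X K (2 * p) (2 * j)) ∈ oddSpan K p) ∧
    (∀ a b, Odd a ∨ Odd b → φ (X K (2 * p) a) (X K (2 * p) b) = 0)}
  zero_mem' := by simp
  add_mem' := by
    rintro φ ψ ⟨h1, h2, h3⟩ ⟨k1, k2, k3⟩
    refine ⟨fun x => by simp [h1, k1], fun i j hi hij hj => ?_, fun a b h => ?_⟩
    · exact (oddSpan K p).add_mem (h2 i j hi hij hj) (k2 i j hi hij hj)
    · simp [h3 a b h, k3 a b h]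
  smul_mem' := by
    rintro c φ ⟨h1, h2, h3⟩
    refine ⟨fun x => by simp [h1], fun i j hi hij hj => ?_, fun a b h => ?_⟩
    · exact (oddSpan K p).smul_mem c (h2 i j hi hij hj)
    · simp [h3 a b h]

/-- The linear family of skew-symmetric maps with
`φ (X (2 i), X (2 j)) = ∑ k ∈ [1, p - 1], a i j k • X (2 k + 1) + b i j • X (2 p)` for
`1 ≤ i < j ≤ p - 1`, the products of basis vectors that are not determined by this being zero. -/
def cocycleFamily₂ (K : Type*) [Field K] (p : ℕ) : Submodule K (Bracket K (2 * p)) where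
  carrier := {φ | (∀ x, φ x x = 0) ∧
    (∀ i j, 1 ≤ i → i < j → j ≤ p - 1 →
      φ (X K (2 * p) (2 * i)) (X K (2 * p) (2 * j)) ∈
        oddSpan K p ⊔ Submodule.span K {X K (2 * p) (2 * p)}) ∧
    (∀ a b, Odd a ∨ Odd b ∨ a = 2 * p ∨ b = 2 * p →
      φ (X K (2 * p) a) (X K (2 * p) b) = 0)}
  zero_mem' := by simp
  add_mem' := by
    rintro φ ψ ⟨h1, h2, h3⟩ ⟨k1, k2, k3⟩
    refine ⟨fun x => by simp [h1, k1], fun i j hi hij hj => ?_, fun a b h => ?_⟩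
    · exact Submodule.add_mem _ (h2 i j hi hij hj) (k2 i j hi hij hj)
    · simp [h3 a b h, k3 a b h]
  smul_mem' := by
    rintro c φ ⟨h1, h2, h3⟩
    refine ⟨fun x => by simp [h1], fun i j hi hij hj => ?_, fun a b h => ?_⟩
    · exact Submodule.smul_mem _ c (h2 i j hi hij hj)
    · simp [h3 a b h]

/-- All brackets isomorphic to a linear deformation `μ₀ + φ` of the bracket `μ₀` of `g_{p-1,2}` with
`φ ∈ S`, i.e. the union of the orbits of these deformations under the action
`(f · μ) (x, y) = f⁻¹ μ (f x, f y)` of the general linear group. -/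
def deformationOrbits {K : Type*} [Field K] {p : ℕ} (S : Submodule K (Bracket K (2 * p))) :
    Set (Bracket K (2 * p)) :=
  {μ | ∃ φ ∈ S, ∃ f : (Fin (2 * p) → K) ≃ₗ[K] (Fin (2 * p) → K),
    ∀ x y, μ x y = f.symm ((baseBracket K p + φ) (f x) (f y))}

/-- The component of the first linear family. -/
def component₁ (K : Type*) [Field K] (p : ℕ) : Set (Bracket K (2 * p)) :=
  deformationOrbits (cocycleFamily₁ K p)

/-- The component of the second linear family. -/
def component₂ (K : Type*) [Field K] (p : ℕ) : Set (Bracket K (2 * p)) :=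
  deformationOrbits (cocycleFamily₂ K p)

end TwoNilpotent

namespace TwoNilpotent

open Module

/-! Write `g` for the algebra and take `x` outside `[g, g]`. As `[g, g]` is central, `ker (ad x)`
contains `im (ad x)` and, independently, the line of `x`; hence `2 * rank (ad x) + 1 ≤ 2 * p` and
the rank is at most `p - 1`. Since `(ad x)² = 0`, the Jordan blocks have size at most `2`, so the
characteristic sequence is the prescribed one exactly when some `ad x` reaches rank `p - 1`
(`mem_family_iff`). This is an open condition.

For such an `x`, choose `u i` whose brackets `[x, u i]` form a basis of `im (ad x)`, and `w`
completing `im (ad x)` and `x` to `ker (ad x)`. The vectors `x, u i, [x, u i], w` form a basis of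
the algebra in which the bracket is `μ₀ + φ`, with `φ` vanishing on all odd basis vectors
(`exists_adapted_equiv`). If `dim [g, g] ≤ p - 1`, then `[g, g] = im (ad x)` and `φ` lies in the
first family. If the centre has dimension at least `p`, then for `p ≥ 2` the vector `w` can be taken
central; the centre is then `im (ad x)` plus the line of `w`, it contains `[g, g]`, and `φ` lies in
the second family. Conversely, these two dimension conditions characterize the two pieces
(`mem_component₁_iff`, `mem_component₂_iff`). They cover the family because `[g, g]` lies in the
centre, and both are closed by semicontinuity of rank.

Each piece is swept out by a linear space of cocycles and the general linear group, and any two of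
its points are joined by a polynomial curve that stays in the piece for all but finitely many
parameters; so it is irreducible (`isPreirreducible_deformationOrbits`). For `p ≥ 3` one explicit
bracket in each piece violates the condition of the other; for `p ≤ 2` the pieces coincide. -/

/-- The polynomial functions on the space of products. -/
noncomputable def regular (K : Type*) [Field K] (n : ℕ) : Subalgebra K (Bracket K n → K) :=
  (MvPolynomial.aeval (fun t (μ : Bracket K n) => structConst μ t) :
    MvPolynomial (Fin n × Fin n × Fin n) K →ₐ[K] (Bracket K n → K)).range

/-! ### Regular functions, semicontinuity of rank, and a criterion for irreducible components -/

section Regular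

variable {K : Type*} [Field K] {n : ℕ}

theorem mem_regular_iff {g : Bracket K n → K} :
    g ∈ regular K n ↔ ∃ f : MvPolynomial (Fin n × Fin n × Fin n) K,
      ∀ μ, g μ = MvPolynomial.eval (structConst μ) f := by
  have key : ∀ (f : MvPolynomial (Fin n × Fin n × Fin n) K) (μ : Bracket K n),
      MvPolynomial.aeval (fun t (μ : Bracket K n) => structConst μ t) f μ =
        MvPolynomial.eval (structConst μ) f := by
    intro f μ
    have := MvPolynomial.comp_aeval_apply (R := K)
      (f := fun t (μ : Bracket K n) => structConst μ t)
      (Pi.evalAlgHom K (fun _ : Bracket K n => K) μ) f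
    simpa [MvPolynomial.aeval_eq_eval] using this
  constructor
  · rintro ⟨f, rfl⟩
    exact ⟨f, key f⟩
  · rintro ⟨f, hf⟩
    exact ⟨f, funext fun μ => (key f μ).trans (hf μ).symm⟩

theorem structConst_mem_regular (t : Fin n × Fin n × Fin n) :
    (fun μ : Bracket K n => structConst μ t) ∈ regular K n :=
  mem_regular_iff.2 ⟨MvPolynomial.X t, by simp⟩

theorem eq_sum_smul_single {ι : Type*} [Fintype ι] [DecidableEq ι] (x : ι → K) :
    x = ∑ i, x i • Pi.single i (1 : K) := by
  simpa using ((Pi.basisFun K ι).sum_repr x).symm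

theorem apply_eq_sum (μ : Bracket K n) (x y : Fin n → K) (k : Fin n) :
    μ x y k = ∑ i, ∑ j, x i * (y j * structConst μ (i, j, k)) := by
  conv_lhs => rw [eq_sum_smul_single x, eq_sum_smul_single y]
  simp only [map_sum, map_smul, LinearMap.sum_apply, LinearMap.smul_apply, Finset.sum_apply,
    Pi.smul_apply, smul_eq_mul, structConst, Finset.mul_sum]
  rw [Finset.sum_comm]
  simp only [mul_left_comm]

theorem apply_mem_regular (x y : Fin n → K) (k : Fin n) :
    (fun μ : Bracket K n => μ x y k) ∈ regular K n := by
  have h : (fun μ : Bracket K n => μ x y k) =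
      ∑ i, ∑ j, x i • (y j • fun μ : Bracket K n => structConst μ (i, j, k)) := by
    ext μ
    simp [apply_eq_sum μ x y k, Finset.sum_apply]
  rw [h]
  exact sum_mem fun i _ => sum_mem fun j _ => Subalgebra.smul_mem _
    (Subalgebra.smul_mem _ (structConst_mem_regular _) _) _

theorem isOpen_ne_zero {g : Bracket K n → K} (hg : g ∈ regular K n) : IsOpen {μ | g μ ≠ 0} := by
  obtain ⟨f, hf⟩ := mem_regular_iff.1 hg
  exact TopologicalSpace.isOpen_generateFrom_of_mem ⟨f, by simp [hf]⟩

/-- The generating sets are already a basis: a product of two regular functions is nonzero precisely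
on the intersection. -/
theorem exists_regular_of_isOpen {U : Set (Bracket K n)} (hU : IsOpen U) {μ : Bracket K n}
    (hμ : μ ∈ U) : ∃ g ∈ regular K n, g μ ≠ 0 ∧ ∀ ν, g ν ≠ 0 → ν ∈ U := by
  induction hU with
  | basic s hs =>
    obtain ⟨f, rfl⟩ := hs
    exact ⟨fun ν => MvPolynomial.eval (structConst ν) f, mem_regular_iff.2 ⟨f, fun _ => rfl⟩, hμ,
      fun _ h => h⟩
  | univ => exact ⟨1, one_mem _, by simp, fun _ _ => trivial⟩
  | inter s t _ _ hs ht =>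
    obtain ⟨g, hg, h1, h2⟩ := hs hμ.1
    obtain ⟨g', hg', h1', h2'⟩ := ht hμ.2
    refine ⟨g * g', mul_mem hg hg', mul_ne_zero h1 h1', fun ν h => ?_⟩
    exact ⟨h2 ν (left_ne_zero_of_mul h), h2' ν (right_ne_zero_of_mul h)⟩
  | sUnion S _ hS =>
    obtain ⟨s, hs, hμs⟩ := hμ
    obtain ⟨g, hg, h1, h2⟩ := hS s hs hμs
    exact ⟨g, hg, h1, fun ν h => ⟨s, hs, h2 ν h⟩⟩

theorem exists_linearIndependent_of_le_finrank_range {V W : Type*} [AddCommGroup V] [Module K V]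
    [AddCommGroup W] [Module K W] (T : V →ₗ[K] W) {r : ℕ}
    (h : r ≤ finrank K (LinearMap.range T)) :
    ∃ v : Fin r → V, LinearIndependent K fun i => T (v i) := by
  obtain ⟨w, hw⟩ := exists_linearIndependent_of_le_finrank h
  choose v hv using fun i => (w i).2
  refine ⟨v, ?_⟩
  have := hw.map' (LinearMap.range T).subtype (Submodule.ker_subtype _)
  simpa [Function.comp_def, hv] using this

theorem le_finrank_range_of_linearIndependent {V W ι : Type*} [AddCommGroup V] [Module K V]
    [AddCommGroup W] [Module K W] [FiniteDimensional K W] [Fintype ι] (T : V →ₗ[K] W) (v : ι → V)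
    (h : LinearIndependent K fun i => T (v i)) :
    Fintype.card ι ≤ finrank K (LinearMap.range T) := by
  rw [← finrank_span_eq_card h]
  refine Submodule.finrank_mono (Submodule.span_le.2 ?_)
  rintro _ ⟨i, rfl⟩
  exact ⟨v i, rfl⟩

/-- Near `μ₀`, rank at least `r` is witnessed by one `r × r` minor. Fix `r` vectors with independent
images under `T μ₀` and a left inverse `L` for these images; the determinant of the matrix of `L (T
μ (v i))` is regular in `μ`, equals `1` at `μ₀`, and wherever it is nonzero the images stay
independent. -/
theorem isOpen_le_finrank_range {V ι : Type*} [AddCommGroup V] [Module K V] [Fintype ι]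
    (T : Bracket K n → V →ₗ[K] (ι → K))
    (hT : ∀ v i, (fun μ => T μ v i) ∈ regular K n) (r : ℕ) :
    IsOpen {μ | r ≤ finrank K (LinearMap.range (T μ))} := by
  classical
  refine isOpen_iff_forall_mem_open.2 fun μ₀ hμ₀ => ?_
  obtain ⟨v, hv⟩ := exists_linearIndependent_of_le_finrank_range (T μ₀) hμ₀
  obtain ⟨L, hL⟩ := LinearMap.exists_leftInverse_of_injective
    (Fintype.linearCombination K fun i => T μ₀ (v i))
    (LinearMap.ker_eq_bot.2 (linearIndependent_iff_injective_fintypeLinearCombination.1 hv))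
  let A : Bracket K n → Matrix (Fin r) (Fin r) K := fun μ => Matrix.of fun i => L (T μ (v i))
  have hA : ∀ i j, (fun μ => A μ i j) ∈ regular K n := by
    intro i j
    have h : (fun μ => A μ i j) =
        ∑ k, L (Pi.single k 1) j • fun μ : Bracket K n => T μ (v i) k := by
      ext μ
      simp only [A, Matrix.of_apply, Finset.sum_apply, Pi.smul_apply, smul_eq_mul]
      conv_lhs => rw [eq_sum_smul_single (T μ (v i))]
      simp only [map_sum, map_smul, Finset.sum_apply, Pi.smul_apply, smul_eq_mul, mul_comm]
    rw [h]
    exact sum_mem fun k _ => Subalgebra.smul_mem _ (hT _ _) _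
  have hdet : (fun μ => (A μ).det) ∈ regular K n := by
    have h : (fun μ => (A μ).det) =
        ∑ σ : Equiv.Perm (Fin r), ((Equiv.Perm.sign σ : ℤ) : K) • ∏ i, fun μ => A μ (σ i) i := by
      ext μ
      simp [Matrix.det_apply', Finset.sum_apply, Finset.prod_apply]
    rw [h]
    exact sum_mem fun σ _ => Subalgebra.smul_mem _ (prod_mem fun i _ => hA _ _) _
  refine ⟨_, fun μ hμ => ?_, isOpen_ne_zero hdet, ?_⟩
  · have h := Matrix.linearIndependent_rows_of_det_ne_zero (A := A μ) hμ
    have h' : LinearIndependent K fun i => T μ (v i) := LinearIndependent.of_comp L h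
    simpa using le_finrank_range_of_linearIndependent (T μ) v h'
  · have h1 : A μ₀ = 1 := by
      ext i j
      have := congrFun (LinearMap.congr_fun hL (Pi.single i 1)) j
      simpa [A, Matrix.one_apply, Pi.single_apply, Fintype.linearCombination_apply,
        eq_comm] using this
    simp [h1]

/-- An irreducible set covered by two closed sets lies in one of them. The last two hypotheses
exclude only proper inclusions, so that `A = B` is allowed. -/
theorem irreducibleComponents_eq_pair {Y : Type*} [TopologicalSpace Y] {A B : Set Y}
    (hA : IsIrreducible A) (hB : IsIrreducible B) (hAc : IsClosed A) (hBc : IsClosed B)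
    (hAB : A ∪ B = Set.univ) (h1 : A ⊆ B → A = B) (h2 : B ⊆ A → A = B) :
    irreducibleComponents Y = {A, B} := by
  have key : ∀ s : Set Y, IsIrreducible s → s ⊆ A ∨ s ⊆ B := fun s hs =>
    isPreirreducible_iff_isClosed_union_isClosed.1 hs.2 A B hAc hBc (by simp [hAB])
  ext s
  simp only [irreducibleComponents, Set.mem_ofPred_eq, Set.mem_insert_iff, Set.mem_singleton_iff]
  constructor
  · rintro ⟨hs, hmax⟩
    rcases key s hs with h | h
    · exact Or.inl (h.antisymm (hmax hA h))
    · exact Or.inr (h.antisymm (hmax hB h))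
  · rintro (rfl | rfl)
    · refine ⟨hA, fun t ht hst => ?_⟩
      rcases key t ht with h | h
      · exact h
      · exact h1 (hst.trans h) ▸ h
    · refine ⟨hB, fun t ht hst => ?_⟩
      rcases key t ht with h | h
      · exact (h2 (hst.trans h)) ▸ h
      · exact h

end Regular

/-! ### Jordan types and their lexicographic bound -/

section JordanType

variable {K V : Type*} [Field K] [AddCommGroup V] [Module K V] {N : Module.End K V} {s : List ℕ}

theorem IsJordanType.sum_eq_finrank (h : IsJordanType N s) : s.sum = finrank K V := by
  obtain ⟨-, -, b, -⟩ := h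
  rw [finrank_eq_card_basis b, Fintype.card_sigma]
  simp only [Fintype.card_fin]
  simp

/-- In each block, every basis vector but the last is sent to the next one, so these images are
distinct basis vectors. -/
theorem IsJordanType.sum_pred_le_finrank_range [FiniteDimensional K V] (h : IsJordanType N s) :
    (s.map fun d => d - 1).sum ≤ finrank K (LinearMap.range N) := by
  obtain ⟨-, -, b, hb⟩ := h
  let v : (Σ i : Fin s.length, Fin (s.get i - 1)) → V := fun t => b ⟨t.1, ⟨t.2, by omega⟩⟩
  have hv : LinearIndependent K fun t => N (v t) := by
    have h : (fun t => N (v t)) =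
        b ∘ fun t : (Σ i : Fin s.length, Fin (s.get i - 1)) => ⟨t.1, ⟨t.2 + 1, by omega⟩⟩ := by
      ext t
      have : t.2.val + 1 < s.get t.1 := by omega
      simp only [v, hb, Function.comp_apply]
      rw [dif_pos this]
    rw [h]
    refine b.linearIndependent.comp _ ?_
    rintro ⟨i, j⟩ ⟨i', j'⟩ hij
    simp only [Sigma.mk.injEq] at hij
    obtain ⟨rfl, hij⟩ := hij
    simpa [Fin.ext_iff] using hij
  have := le_finrank_range_of_linearIndependent N v hv
  rw [Fintype.card_sigma] at this
  simp only [Fintype.card_fin] at this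
  rwa [← Fin.sum_univ_fun_getElem s (fun d => d - 1)]

theorem IsJordanType.le_two (h : IsJordanType N s) (hN : ∀ v, N (N v) = 0) : ∀ d ∈ s, d ≤ 2 := by
  obtain ⟨-, -, b, hb⟩ := h
  intro d hd
  obtain ⟨i, rfl⟩ := List.mem_iff_get.1 hd
  by_contra! h3
  have h1 := hb i ⟨0, by omega⟩
  have h2 := hb i ⟨1, by omega⟩
  rw [dif_pos (show 0 + 1 < s.get i by omega)] at h1
  rw [dif_pos (show 1 + 1 < s.get i by omega)] at h2
  refine b.ne_zero ⟨i, ⟨1 + 1, by omega⟩⟩ ?_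
  rw [← h2, ← hN (b ⟨i, ⟨0, by omega⟩⟩), h1]

end JordanType

/-- A list with entries `1` and `2` that starts with `1` is already smaller when `q > 0`; one that
starts with `2` reduces to its tail. For `q = 0` the rank bound forces every entry to be `1`. -/
theorem list_le_replicate_two_append (q : ℕ) (c : List ℕ) (h0 : ∀ d ∈ c, 0 < d)
    (h2 : ∀ d ∈ c, d ≤ 2) (hsum : c.sum = 2 * q + 2) (hq : (c.map fun d => d - 1).sum ≤ q) :
    c ≤ List.replicate q 2 ++ [1, 1] := by
  induction q generalizing c with
  | zero =>
    have h1 : ∀ d ∈ c, d = 1 := by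
      intro d hd
      have := List.single_le_sum (l := c.map fun d => d - 1) (by simp) (d - 1)
        (List.mem_map_of_mem hd)
      have := h0 d hd
      omega
    have hc := List.eq_replicate_of_mem h1
    rw [hc] at hsum
    simp only [List.sum_replicate, smul_eq_mul, mul_one] at hsum
    rw [hc, hsum]
    simp
  | succ q ih =>
    rcases c with _ | ⟨a, c⟩
    · simp at hsum
    · have ha0 := h0 a (by simp)
      have ha2 := h2 a (by simp)
      rw [List.replicate_succ, List.cons_append, ← not_lt, List.cons_lt_cons_iff]
      rcases ha2.lt_or_eq with h | rfl
      · omega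
      · refine fun h => (h.resolve_left (lt_irrefl 2)).2.not_ge (ih c (fun d hd => h0 d (by simp [hd])) (fun d hd => h2 d (by simp [hd]))
          ?_ ?_)
        · simp at hsum; omega
        · simp at hq; omega

/-! ### Ranks of adjoint operators and the characteristic sequence -/

section Basic

variable {K : Type*} [Field K] {n : ℕ} {μ : Bracket K n}

theorem apply_mem_derivedIdeal (μ : Bracket K n) (x y : Fin n → K) : μ x y ∈ derivedIdeal μ :=
  Submodule.subset_span ⟨x, y, rfl⟩

theorem derivedIdeal_le {S : Submodule K (Fin n → K)} (h : ∀ x y, μ x y ∈ S) :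
    derivedIdeal μ ≤ S :=
  Submodule.span_le.2 (by rintro _ ⟨x, y, rfl⟩; exact h x y)

theorem range_le_derivedIdeal (μ : Bracket K n) (x : Fin n → K) :
    LinearMap.range (μ x) ≤ derivedIdeal μ := by
  rintro _ ⟨y, rfl⟩
  exact apply_mem_derivedIdeal μ x y

theorem apply_eq_neg (h : ∀ x, μ x x = 0) (x y : Fin n → K) : μ x y = -μ y x := by
  have := h (x + y)
  simp only [map_add, LinearMap.add_apply, h, add_zero, zero_add] at this
  exact eq_neg_of_add_eq_zero_right this

theorem derivedIdeal_le_ker (hμ : μ ∈ twoNilp K n) : derivedIdeal μ ≤ LinearMap.ker μ :=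
  derivedIdeal_le fun x y => LinearMap.ext fun z => hμ.2 x y z

theorem apply_apply_eq_zero (hμ : μ ∈ twoNilp K n) (x y z : Fin n → K) : μ x (μ y z) = 0 := by
  rw [apply_eq_neg hμ.1, hμ.2, neg_zero]

theorem ker_le_ker_apply (hμ : μ ∈ twoNilp K n) (x : Fin n → K) :
    LinearMap.ker μ ≤ LinearMap.ker (μ x) := by
  intro z hz
  rw [LinearMap.mem_ker] at hz ⊢
  rw [apply_eq_neg hμ.1, hz, LinearMap.zero_apply, neg_zero]

theorem exists_notMem_derivedIdeal (hμ : μ ∈ twoNilp K n) (hn : 0 < n) :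
    ∃ x, x ∉ derivedIdeal μ := by
  by_contra! h
  have h0 : μ = 0 := LinearMap.ext fun x => derivedIdeal_le_ker hμ (h x)
  have : Nonempty (Fin n) := ⟨⟨0, hn⟩⟩
  obtain ⟨v, hv⟩ := exists_ne (0 : Fin n → K)
  refine hv ?_
  have h1 : derivedIdeal μ ≤ ⊥ := derivedIdeal_le fun x y => by simp [h0]
  exact h1 (h v)

theorem sup_span_le_ker (hμ : μ ∈ twoNilp K n) (x : Fin n → K) :
    LinearMap.range (μ x) ⊔ Submodule.span K {x} ≤ LinearMap.ker (μ x) := by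
  refine sup_le ?_ ?_
  · exact (range_le_derivedIdeal μ x).trans ((derivedIdeal_le_ker hμ).trans (ker_le_ker_apply hμ x))
  · rw [Submodule.span_singleton_le_iff_mem, LinearMap.mem_ker, hμ.1]

theorem finrank_range_sup_span {x : Fin n → K} (hx : x ∉ derivedIdeal μ) :
    finrank K ↥(LinearMap.range (μ x) ⊔ Submodule.span K {x}) =
      finrank K (LinearMap.range (μ x)) + 1 :=
  Submodule.finrank_sup_span_singleton fun h => hx (range_le_derivedIdeal μ x h)

theorem finrank_range_add_finrank_ker (μ : Bracket K n) (x : Fin n → K) :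
    finrank K (LinearMap.range (μ x)) + finrank K (LinearMap.ker (μ x)) = n := by
  rw [LinearMap.finrank_range_add_finrank_ker, finrank_fin_fun]

theorem finrank_range_le {p : ℕ} {μ : Bracket K (2 * p)} (hμ : μ ∈ twoNilp K (2 * p))
    {x : Fin (2 * p) → K} (hx : x ∉ derivedIdeal μ) :
    finrank K (LinearMap.range (μ x)) ≤ p - 1 := by
  have h1 := Submodule.finrank_mono (sup_span_le_ker hμ x)
  have h2 := finrank_range_add_finrank_ker μ x
  rw [finrank_range_sup_span hx] at h1
  omega

/-- Lifts `u i` of a basis of `im (ad x)` span the space modulo `ker (ad x)`, which by dimension is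
`im (ad x)` plus the lines of `x` and `w`. Spanning is phrased through subspaces so that it can
serve differently indexed bases. -/
theorem exists_generators {p : ℕ} (hp : 1 ≤ p) {μ : Bracket K (2 * p)}
    (hμ : μ ∈ twoNilp K (2 * p)) {x w : Fin (2 * p) → K} (hx : x ∉ derivedIdeal μ)
    (hr : p - 1 ≤ finrank K (LinearMap.range (μ x))) (hw : μ x w = 0)
    (hw' : w ∉ LinearMap.range (μ x) ⊔ Submodule.span K {x}) :
    ∃ u : ℕ → Fin (2 * p) → K, ∀ S : Submodule K (Fin (2 * p) → K), x ∈ S → w ∈ S →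
      (∀ i < p - 1, u i ∈ S ∧ μ x (u i) ∈ S) → S = ⊤ := by
  obtain ⟨v, hv⟩ := exists_linearIndependent_of_le_finrank_range (μ x) hr
  have hle : Submodule.span K (Set.range fun i => μ x (v i)) ≤ LinearMap.range (μ x) := by
    rw [Submodule.span_le]
    rintro _ ⟨i, rfl⟩
    exact ⟨v i, rfl⟩
  have hspan : Submodule.span K (Set.range fun i => μ x (v i)) = LinearMap.range (μ x) := by
    refine Submodule.eq_of_le_of_finrank_le hle ?_
    rw [finrank_span_eq_card hv, Fintype.card_fin]
    exact finrank_range_le hμ hx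
  have hker : LinearMap.range (μ x) ⊔ Submodule.span K {x} ⊔ Submodule.span K {w} =
      LinearMap.ker (μ x) := by
    refine Submodule.eq_of_le_of_finrank_le (sup_le (sup_span_le_ker hμ x) ?_) ?_
    · rwa [Submodule.span_singleton_le_iff_mem, LinearMap.mem_ker]
    · rw [Submodule.finrank_sup_span_singleton hw', finrank_range_sup_span hx]
      have := finrank_range_add_finrank_ker μ x
      omega
  -- The value `0` from index `p - 1` on is never used; indexing by `ℕ` avoids casts between `Fin`
  -- types later.
  refine ⟨fun i => if h : i < p - 1 then v ⟨i, h⟩ else 0, fun S hxS hwS hS => ?_⟩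
  have hvS : ∀ i, v i ∈ S ∧ μ x (v i) ∈ S := fun i => by simpa using hS i i.2
  have hrS : LinearMap.range (μ x) ≤ S := by
    rw [← hspan, Submodule.span_le]
    rintro _ ⟨i, rfl⟩
    exact (hvS i).2
  have hkS : LinearMap.ker (μ x) ≤ S := by
    rw [← hker]
    simp [hrS, hxS, hwS]
  rw [eq_top_iff]
  intro z _
  have hz : μ x z ∈ Submodule.span K (Set.range fun i => μ x (v i)) := hspan ▸ ⟨z, rfl⟩
  obtain ⟨c, hc⟩ := (Submodule.mem_span_range_iff_exists_fun K).1 hz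
  have h1 : z - ∑ i, c i • v i ∈ S := hkS (by simp [hc])
  have h2 : ∑ i, c i • v i ∈ S := sum_mem fun i _ => S.smul_mem _ (hvS i).1
  simpa using S.add_mem h1 h2

theorem exists_complement {p : ℕ} (hp : 1 ≤ p) {μ : Bracket K (2 * p)}
    (hμ : μ ∈ twoNilp K (2 * p)) {x : Fin (2 * p) → K} (hx : x ∉ derivedIdeal μ) :
    ∃ w, μ x w = 0 ∧ w ∉ LinearMap.range (μ x) ⊔ Submodule.span K {x} := by
  by_contra! h
  have h1 : LinearMap.ker (μ x) ≤ LinearMap.range (μ x) ⊔ Submodule.span K {x} := fun w hw => h w hw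
  have h2 := Submodule.finrank_mono h1
  rw [finrank_range_sup_span hx] at h2
  have := finrank_range_add_finrank_ker μ x
  have := finrank_range_le hμ hx
  omega

/-- The Jordan chains are `u i, [x, u i]` for `i < p - 1`, followed by the singletons `x` and `w`.
They span, and their number is `2 * p`. -/
theorem isJordanType_of_le_finrank_range {p : ℕ} (hp : 1 ≤ p) {μ : Bracket K (2 * p)}
    (hμ : μ ∈ twoNilp K (2 * p)) {x : Fin (2 * p) → K} (hx : x ∉ derivedIdeal μ)
    (hr : p - 1 ≤ finrank K (LinearMap.range (μ x))) :
    IsJordanType (μ x) (List.replicate (p - 1) 2 ++ [1, 1]) := by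
  obtain ⟨w, hw, hw'⟩ := exists_complement hp hμ hx
  obtain ⟨u, hu⟩ := exists_generators hp hμ hx hr hw hw'
  set s := List.replicate (p - 1) 2 ++ [1, 1] with hs
  have hlen : s.length = p + 1 := by simp [hs]; omega
  have hget2 : ∀ i : Fin s.length, i.val < p - 1 → s.get i = 2 := by
    intro i hi
    simp [hs, hi]
  have hget1 : ∀ i : Fin s.length, ¬ i.val < p - 1 → s.get i = 1 := by
    intro i hi
    have : i.val - (p - 1) = 0 ∨ i.val - (p - 1) = 1 := by omega
    rcases this with h | h <;> simp [hs, List.getElem_append, hi, h]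
  let g : ℕ → Fin (2 * p) → K := fun i => if i < p - 1 then u i else if i = p - 1 then x else w
  have hg : ∀ i, ¬ i < p - 1 → μ x (g i) = 0 := by
    intro i hi
    simp only [g, if_neg hi]
    split_ifs
    · exact hμ.1 x
    · exact hw
  let b : (Σ i : Fin s.length, Fin (s.get i)) → Fin (2 * p) → K := fun t => ((μ x) ^ t.2.val) (g t.1)
  have hspan : ⊤ ≤ Submodule.span K (Set.range b) := by
    refine (hu _ ?_ ?_ ?_).ge
    · refine Submodule.subset_span ⟨⟨⟨p - 1, by omega⟩, ⟨0, ?_⟩⟩, ?_⟩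
      · rw [hget1] <;> simp
      · simp [b, g]
    · refine Submodule.subset_span ⟨⟨⟨p, by omega⟩, ⟨0, ?_⟩⟩, ?_⟩
      · rw [hget1] <;> simp
      · have : ¬ p < p - 1 := by omega
        have : ¬ p = p - 1 := by omega
        simp [b, g, *]
    · intro i hi
      constructor
      · refine Submodule.subset_span ⟨⟨⟨i, by omega⟩, ⟨0, ?_⟩⟩, ?_⟩
        · rw [hget2] <;> simp [hi]
        · simp [b, g, hi]
      · refine Submodule.subset_span ⟨⟨⟨i, by omega⟩, ⟨1, ?_⟩⟩, ?_⟩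
        · rw [hget2] <;> simp [hi]
        · simp [b, g, hi]
  have hcard : Fintype.card (Σ i : Fin s.length, Fin (s.get i)) = finrank K (Fin (2 * p) → K) := by
    rw [Fintype.card_sigma, finrank_fin_fun]
    simp only [Fintype.card_fin]
    have h' : s.sum = 2 * p := by simp [hs]; omega
    simpa using h'
  refine ⟨?_, ?_, basisOfTopLeSpanOfCardEqFinrank b hspan hcard, fun i j => ?_⟩
  · simp [hs, List.pairwise_append, List.pairwise_replicate]
  · simp [hs]
    omega
  · rw [coe_basisOfTopLeSpanOfCardEqFinrank]
    have hstep : μ x (b ⟨i, j⟩) = ((μ x) ^ (j.val + 1)) (g i) := by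
      simp [b, pow_succ']
    rw [hstep]
    split_ifs with h
    · rfl
    · by_cases hi : i.val < p - 1
      · have := hget2 i hi
        have hj : j.val = 1 := by omega
        rw [hj]
        simp [pow_succ', apply_apply_eq_zero hμ]
      · have := hget1 i hi
        have hj : j.val = 0 := by omega
        simp [hj, hg i hi]

/-- This turns the characteristic sequence into a rank condition, which makes openness accessible.
The maximality in the definition is automatic, since no `ad z` with `z` outside `[g, g]` has larger
rank. -/
theorem mem_family_iff {p : ℕ} (hp : 1 ≤ p) {μ : Bracket K (2 * p)} :
    μ ∈ family K p ↔ μ ∈ twoNilp K (2 * p) ∧ ∃ x, p - 1 ≤ finrank K (LinearMap.range (μ x)) := by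
  refine and_congr_right fun hμ => ⟨?_, ?_⟩
  · rintro ⟨⟨x, -, hx⟩, -⟩
    exact ⟨x, by simpa using hx.sum_pred_le_finrank_range⟩
  · rintro ⟨x, hx⟩
    obtain ⟨y, hy, hy'⟩ : ∃ y, y ∉ derivedIdeal μ ∧ p - 1 ≤ finrank K (LinearMap.range (μ y)) := by
      -- Here `ad x = 0`, which forces `p - 1 = 0`; any vector outside `[g, g]` then serves.
      by_cases h : x ∈ derivedIdeal μ
      · have h0 : μ x = 0 := derivedIdeal_le_ker hμ h
        obtain ⟨y, hy⟩ := exists_notMem_derivedIdeal hμ (by omega)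
        rw [h0, LinearMap.range_zero, finrank_bot] at hx
        exact ⟨y, hy, by omega⟩
      · exact ⟨x, h, hx⟩
    refine ⟨⟨y, hy, isJordanType_of_le_finrank_range hp hμ hy hy'⟩, ?_⟩
    rintro c ⟨z, hz, hc⟩
    refine list_le_replicate_two_append _ c hc.2.1
      (hc.le_two fun v => apply_apply_eq_zero hμ _ _ _) ?_
      (hc.sum_pred_le_finrank_range.trans (finrank_range_le hμ hz))
    rw [hc.sum_eq_finrank, finrank_fin_fun]
    omega

end Basic

/-! ### Adapted bases and intrinsic descriptions of the two pieces -/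

section NormalForm

variable {K : Type*} [Field K]

theorem X_succ {n : ℕ} (i : Fin n) : X K n (i.val + 1) = Pi.single i 1 := by
  ext j
  simp [X, Pi.single_apply, Fin.ext_iff]

theorem X_eq_zero {n a : ℕ} (h : a = 0 ∨ n < a) : X K n a = 0 := by
  ext i
  have : i.val + 1 ≠ a := by omega
  simp [X, this]

theorem X_dotProduct_X (n a b : ℕ) :
    X K n a ⬝ᵥ X K n b = if a = b ∧ 1 ≤ a ∧ a ≤ n then 1 else 0 := by
  by_cases ha : 1 ≤ a ∧ a ≤ n
  · obtain ⟨i, rfl⟩ : ∃ i : Fin n, i.val + 1 = a := ⟨⟨a - 1, by omega⟩, by simp; omega⟩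
    rw [X_succ, single_one_dotProduct]
    simp [X, ha]
  · rw [X_eq_zero (by omega), zero_dotProduct, if_neg (fun h => ha h.2)]

theorem linearMap_ext_X {n : ℕ} {W : Type*} [AddCommGroup W] [Module K W]
    {g h : (Fin n → K) →ₗ[K] W} (H : ∀ a, 1 ≤ a → a ≤ n → g (X K n a) = h (X K n a)) : g = h := by
  refine (Pi.basisFun K (Fin n)).ext fun i => ?_
  rw [Pi.basisFun_apply, ← X_succ]
  exact H _ (by omega) (by omega)

theorem linearMap_mem_of_X {n : ℕ} {W : Type*} [AddCommGroup W] [Module K W]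
    (g : (Fin n → K) →ₗ[K] W) (S : Submodule K W)
    (H : ∀ a, 1 ≤ a → a ≤ n → g (X K n a) ∈ S) (x : Fin n → K) : g x ∈ S := by
  rw [eq_sum_smul_single x, map_sum]
  refine sum_mem fun i _ => ?_
  rw [map_smul, ← X_succ]
  exact S.smul_mem _ (H _ (by omega) (by omega))

theorem bracket_mem_of_X {n : ℕ} (μ : Bracket K n) (S : Submodule K (Fin n → K))
    (H : ∀ a b, 1 ≤ a → a ≤ n → 1 ≤ b → b ≤ n → μ (X K n a) (X K n b) ∈ S) (x y : Fin n → K) :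
    μ x y ∈ S :=
  linearMap_mem_of_X (μ.flip y) S
    (fun a ha ha' => linearMap_mem_of_X (μ (X K n a)) S (fun b hb hb' => H a b ha ha' hb hb') y) x

theorem baseBracket_apply (p : ℕ) (x y : Fin (2 * p) → K) :
    baseBracket K p x y = ∑ i ∈ Finset.Icc 1 (p - 1),
      ((X K (2 * p) 1 ⬝ᵥ x) * (X K (2 * p) (2 * i) ⬝ᵥ y) -
        (X K (2 * p) (2 * i) ⬝ᵥ x) * (X K (2 * p) 1 ⬝ᵥ y)) • X K (2 * p) (2 * i + 1) := by
  simp [baseBracket, elementary, LinearMap.sum_apply]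

theorem baseBracket_self (p : ℕ) (x : Fin (2 * p) → K) : baseBracket K p x x = 0 := by
  rw [baseBracket_apply]
  refine Finset.sum_eq_zero fun i _ => ?_
  rw [mul_comm (X K (2 * p) 1 ⬝ᵥ x), sub_self, zero_smul]

theorem baseBracket_mem_oddSpan (p : ℕ) (x y : Fin (2 * p) → K) :
    baseBracket K p x y ∈ oddSpan K p := by
  rw [baseBracket_apply]
  refine sum_mem fun i hi => Submodule.smul_mem _ _ (Submodule.subset_span ⟨i, ?_, ?_, rfl⟩)
  · exact (Finset.mem_Icc.1 hi).1
  · exact (Finset.mem_Icc.1 hi).2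

theorem baseBracket_X_one_X_even {p i : ℕ} (hi : 1 ≤ i) (hi' : i ≤ p - 1) :
    baseBracket K p (X K (2 * p) 1) (X K (2 * p) (2 * i)) = X K (2 * p) (2 * i + 1) := by
  rw [baseBracket_apply, Finset.sum_eq_single i]
  · have h1 : ¬ 2 * i = 1 := by omega
    have h2 : 1 ≤ 2 * p := by omega
    have h3 : 1 ≤ 2 * i ∧ 2 * i ≤ 2 * p := by omega
    simp only [X_dotProduct_X]
    simp [h1, h2, h3]
  · intro j _ hj
    have h1 : ¬ 2 * j = 1 := by omega
    have h2 : ¬ 2 * j = 2 * i := by omega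
    simp only [X_dotProduct_X]
    simp [h1, h2]
  · intro h
    exact absurd (Finset.mem_Icc.2 ⟨hi, hi'⟩) h

theorem baseBracket_X_X {p a b : ℕ} (ha : a ≠ 1) (hb : b ≠ 1) :
    baseBracket K p (X K (2 * p) a) (X K (2 * p) b) = 0 := by
  rw [baseBracket_apply]
  refine Finset.sum_eq_zero fun i _ => ?_
  simp only [X_dotProduct_X]
  simp [ha.symm, hb.symm]

theorem baseBracket_X_eq_zero {p a : ℕ} (ha : a ≠ 1) (ha' : Odd a ∨ a = 2 * p) :
    baseBracket K p (X K (2 * p) a) = 0 := by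
  refine LinearMap.ext fun y => ?_
  rw [baseBracket_apply]
  refine Finset.sum_eq_zero fun i hi => ?_
  have h1 : ¬ 2 * i = a := by
    rw [Finset.mem_Icc] at hi
    rcases ha' with ⟨k, rfl⟩ | rfl <;> omega
  simp only [X_dotProduct_X]
  simp [ha.symm, h1]

theorem baseBracket_X_one_X {p b : ℕ} (hb : Odd b ∨ b = 2 * p) :
    baseBracket K p (X K (2 * p) 1) (X K (2 * p) b) = 0 := by
  by_cases h : b = 1
  · rw [h, baseBracket_self]
  · rw [apply_eq_neg (baseBracket_self p), baseBracket_X_eq_zero h hb]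
    simp

/-- The span of `oddSpan K p` and the vector `X (2 p)`. -/
def oddSpanSup (K : Type*) [Field K] (p : ℕ) : Submodule K (Fin (2 * p) → K) :=
  oddSpan K p ⊔ Submodule.span K {X K (2 * p) (2 * p)}

theorem X_odd_mem_oddSpan {p k : ℕ} (hk : 1 ≤ k) (hk' : k ≤ p - 1) :
    X K (2 * p) (2 * k + 1) ∈ oddSpan K p :=
  Submodule.subset_span ⟨k, hk, hk', rfl⟩

theorem X_mem_oddSpanSup (p : ℕ) : X K (2 * p) (2 * p) ∈ oddSpanSup K p :=
  (le_sup_right : _ ≤ oddSpanSup K p) (Submodule.mem_span_singleton_self _)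

theorem linearIndependent_X_odd (p : ℕ) :
    LinearIndependent K fun k : Fin (p - 1) => X K (2 * p) (2 * (k.val + 1) + 1) := by
  have h : (fun k : Fin (p - 1) => X K (2 * p) (2 * (k.val + 1) + 1)) =
      Pi.basisFun K (Fin (2 * p)) ∘ fun k : Fin (p - 1) => ⟨2 * (k.val + 1), by omega⟩ := by
    ext1 k
    rw [Function.comp_apply, Pi.basisFun_apply, ← X_succ]
  rw [h]
  refine (Pi.basisFun K (Fin (2 * p))).linearIndependent.comp _ fun i j hij => ?_
  simpa [Fin.ext_iff] using hij

theorem finrank_oddSpan (p : ℕ) : finrank K (oddSpan K p) = p - 1 := by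
  have h : oddSpan K p =
      Submodule.span K (Set.range fun k : Fin (p - 1) => X K (2 * p) (2 * (k.val + 1) + 1)) := by
    unfold oddSpan
    congr 1
    ext v
    constructor
    · rintro ⟨k, h1, h2, rfl⟩
      exact ⟨⟨k - 1, by omega⟩, by simp [Nat.sub_add_cancel h1]⟩
    · rintro ⟨k, rfl⟩
      exact ⟨k + 1, by omega, by omega, rfl⟩
  rw [h, finrank_span_eq_card (linearIndependent_X_odd p), Fintype.card_fin]

theorem X_notMem_oddSpan {p a : ℕ} (ha : 1 ≤ a) (ha' : a ≤ 2 * p) (h : a = 1 ∨ Even a) :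
    X K (2 * p) a ∉ oddSpan K p := by
  intro hm
  have key : oddSpan K p ≤ LinearMap.ker (LinearMap.proj (R := K) (⟨a - 1, by omega⟩ : Fin (2 * p))) := by
    refine Submodule.span_le.2 ?_
    rintro _ ⟨k, hk, -, rfl⟩
    have : ¬ a - 1 = 2 * k := by
      rcases h with rfl | ⟨j, rfl⟩ <;> omega
    simp [X, this]
  have := key hm
  simp [X, Nat.sub_add_cancel ha] at this

theorem finrank_oddSpanSup {p : ℕ} (hp : 1 ≤ p) : finrank K (oddSpanSup K p) = p := by
  unfold oddSpanSup
  rw [Submodule.finrank_sup_span_singleton (X_notMem_oddSpan (by omega) le_rfl (Or.inr (by simp))),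
    finrank_oddSpan]
  omega

theorem baseBracket_oddSpanSup {p : ℕ} {s : Fin (2 * p) → K} (hs : s ∈ oddSpanSup K p) :
    baseBracket K p s = 0 := by
  have h : oddSpanSup K p ≤ LinearMap.ker (baseBracket K p) := by
    refine sup_le (Submodule.span_le.2 ?_) ?_
    · rintro _ ⟨k, hk, -, rfl⟩
      exact baseBracket_X_eq_zero (by omega) (Or.inl ⟨k, rfl⟩)
    · rw [Submodule.span_singleton_le_iff_mem]
      exact baseBracket_X_eq_zero (by omega) (Or.inr rfl)
  exact h hs

/-- The skew-symmetric products with values in `S` that vanish on `S` and on `X 1`. -/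
structure IsDeformation {K : Type*} [Field K] {p : ℕ} (φ : Bracket K (2 * p))
    (S : Submodule K (Fin (2 * p) → K)) : Prop where
  self : ∀ x, φ x x = 0
  mem : ∀ x y, φ x y ∈ S
  eq_zero : ∀ s ∈ S, φ s = 0
  X_one : φ (X K (2 * p) 1) = 0

theorem isDeformation_of_mem₁ {p : ℕ} {φ : Bracket K (2 * p)} (h : φ ∈ cocycleFamily₁ K p) :
    IsDeformation φ (oddSpan K p) := by
  obtain ⟨h1, h2, h3⟩ := h
  have hodd : ∀ a, Odd a → φ (X K (2 * p) a) = 0 := fun a ha =>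
    linearMap_ext_X fun b _ _ => by rw [h3 a b (Or.inl ha), LinearMap.zero_apply]
  refine ⟨h1, bracket_mem_of_X _ _ fun a b ha ha' hb hb' => ?_, fun s hs => ?_, hodd 1 odd_one⟩
  · by_cases hab : Odd a ∨ Odd b
    · rw [h3 a b hab]
      exact zero_mem _
    · rw [not_or, Nat.not_odd_iff_even, Nat.not_odd_iff_even, even_iff_exists_two_mul,
        even_iff_exists_two_mul] at hab
      obtain ⟨⟨i, rfl⟩, ⟨j, rfl⟩⟩ := hab
      rcases lt_trichotomy i j with hij | rfl | hij
      · exact h2 i j (by omega) hij (by omega)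
      · rw [h1]
        exact zero_mem _
      · rw [apply_eq_neg h1]
        exact neg_mem (h2 j i (by omega) hij (by omega))
  · have : oddSpan K p ≤ LinearMap.ker φ := by
      refine Submodule.span_le.2 ?_
      rintro _ ⟨k, hk, -, rfl⟩
      exact hodd _ ⟨k, rfl⟩
    exact this hs

theorem isDeformation_of_mem₂ {p : ℕ} {φ : Bracket K (2 * p)} (h : φ ∈ cocycleFamily₂ K p) :
    IsDeformation φ (oddSpanSup K p) := by
  obtain ⟨h1, h2, h3⟩ := h
  have hodd : ∀ a, Odd a ∨ a = 2 * p → φ (X K (2 * p) a) = 0 := fun a ha =>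
    linearMap_ext_X fun b _ _ => by rw [h3 a b (by tauto), LinearMap.zero_apply]
  refine ⟨h1, bracket_mem_of_X _ _ fun a b ha ha' hb hb' => ?_, fun s hs => ?_,
    hodd 1 (Or.inl odd_one)⟩
  · by_cases hab : Odd a ∨ Odd b ∨ a = 2 * p ∨ b = 2 * p
    · rw [h3 a b hab]
      exact zero_mem _
    · rw [not_or, not_or, not_or, Nat.not_odd_iff_even, Nat.not_odd_iff_even,
        even_iff_exists_two_mul, even_iff_exists_two_mul] at hab
      obtain ⟨⟨i, rfl⟩, ⟨j, rfl⟩, hi, hj⟩ := hab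
      rcases lt_trichotomy i j with hij | rfl | hij
      · exact h2 i j (by omega) hij (by omega)
      · rw [h1]
        exact zero_mem _
      · rw [apply_eq_neg h1]
        exact neg_mem (h2 j i (by omega) hij (by omega))
  · have : oddSpanSup K p ≤ LinearMap.ker φ := by
      refine sup_le (Submodule.span_le.2 ?_) ?_
      · rintro _ ⟨k, hk, -, rfl⟩
        exact hodd _ (Or.inl ⟨k, rfl⟩)
      · rw [Submodule.span_singleton_le_iff_mem]
        exact hodd _ (Or.inr rfl)
    exact this hs

/-- Both terms vanish separately: values of `φ` are central for `μ₀`, and values of `μ₀` lie in `S`,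
where `φ` vanishes. -/
theorem IsDeformation.mem_cocycles {p : ℕ} {φ : Bracket K (2 * p)}
    {S : Submodule K (Fin (2 * p) → K)} (h : IsDeformation φ S) (hS : oddSpan K p ≤ S)
    (hS' : S ≤ oddSpanSup K p) : φ ∈ cocycles (baseBracket K p) := by
  refine ⟨h.self, fun x y z => ?_⟩
  rw [apply_eq_neg (baseBracket_self p), baseBracket_oddSpanSup (hS' (h.mem y z)),
    apply_eq_neg h.self, h.eq_zero _ (hS (baseBracket_mem_oddSpan p y z))]
  simp

section Isomorphic

variable {p : ℕ} {μ φ : Bracket K (2 * p)} {S : Submodule K (Fin (2 * p) → K)}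
  {f : (Fin (2 * p) → K) ≃ₗ[K] (Fin (2 * p) → K)}

theorem IsDeformation.apply_mem (h : IsDeformation φ S) (hS : oddSpan K p ≤ S)
    (hμ : ∀ x y, μ x y = f.symm ((baseBracket K p + φ) (f x) (f y))) (x y : Fin (2 * p) → K) :
    f (μ x y) ∈ S := by
  rw [hμ, LinearEquiv.apply_symm_apply]
  exact S.add_mem (hS (baseBracket_mem_oddSpan p _ _)) (h.mem _ _)

theorem IsDeformation.apply_eq_zero (h : IsDeformation φ S) (hS' : S ≤ oddSpanSup K p)
    (hμ : ∀ x y, μ x y = f.symm ((baseBracket K p + φ) (f x) (f y))) {x : Fin (2 * p) → K}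
    (hx : f x ∈ S) : μ x = 0 := by
  refine LinearMap.ext fun y => ?_
  rw [hμ, LinearMap.add_apply, h.eq_zero _ hx, baseBracket_oddSpanSup (hS' hx)]
  simp

/-- Since `φ` vanishes on `X 1`, the deformation keeps `ad (X 1)`, whose rank is at least `p - 1`;
values of the new bracket correspond to elements of `S`, which remain central. -/
theorem IsDeformation.mem_family (hp : 1 ≤ p) (h : IsDeformation φ S) (hS : oddSpan K p ≤ S)
    (hS' : S ≤ oddSpanSup K p)
    (hμ : ∀ x y, μ x y = f.symm ((baseBracket K p + φ) (f x) (f y))) : μ ∈ family K p := by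
  refine (mem_family_iff hp).2 ⟨⟨fun x => ?_, fun x y z => ?_⟩, f.symm (X K (2 * p) 1), ?_⟩
  · simp [hμ, baseBracket_self, h.self]
  · rw [h.apply_eq_zero hS' hμ (h.apply_mem hS hμ x y), LinearMap.zero_apply]
  · have hle : (oddSpan K p).map f.symm.toLinearMap ≤
        LinearMap.range (μ (f.symm (X K (2 * p) 1))) := by
      rw [Submodule.map_le_iff_le_comap]
      refine Submodule.span_le.2 ?_
      rintro _ ⟨k, hk, hk', rfl⟩
      refine ⟨f.symm (X K (2 * p) (2 * k)), ?_⟩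
      rw [hμ]
      simp [h.X_one, baseBracket_X_one_X_even hk hk']
    refine le_trans (le_of_eq ?_) (Submodule.finrank_mono hle)
    rw [LinearEquiv.finrank_map_eq, finrank_oddSpan]

theorem IsDeformation.finrank_derivedIdeal_le (h : IsDeformation φ S) (hS : oddSpan K p ≤ S)
    (hμ : ∀ x y, μ x y = f.symm ((baseBracket K p + φ) (f x) (f y))) :
    finrank K (derivedIdeal μ) ≤ finrank K S := by
  rw [← LinearEquiv.finrank_map_eq f.symm S]
  refine Submodule.finrank_mono (derivedIdeal_le fun x y => ?_)
  exact ⟨f (μ x y), h.apply_mem hS hμ x y, by simp⟩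

theorem IsDeformation.le_finrank_ker (h : IsDeformation φ S) (hS' : S ≤ oddSpanSup K p)
    (hμ : ∀ x y, μ x y = f.symm ((baseBracket K p + φ) (f x) (f y))) :
    finrank K S ≤ finrank K (LinearMap.ker μ) := by
  rw [← LinearEquiv.finrank_map_eq f.symm S]
  refine Submodule.finrank_mono ?_
  rintro _ ⟨s, hs, rfl⟩
  exact h.apply_eq_zero hS' hμ (by simpa using hs)

end Isomorphic

/-- The coordinates send `x, w, u i, [x, u i]` to `X 1`, `X (2 p)`, `X (2 i + 2)`, `X (2 i + 3)`.
The final clause makes the difference from `μ₀` vanish on odd basis vectors: for `X 1` by the choice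
of the basis, for the others because brackets are central. -/
theorem exists_adapted_equiv {p : ℕ} (hp : 1 ≤ p) {μ : Bracket K (2 * p)}
    (hμ : μ ∈ twoNilp K (2 * p)) {x w : Fin (2 * p) → K} (hx : x ∉ derivedIdeal μ)
    (hr : p - 1 ≤ finrank K (LinearMap.range (μ x))) (hw : μ x w = 0)
    (hw' : w ∉ LinearMap.range (μ x) ⊔ Submodule.span K {x}) :
    ∃ f : (Fin (2 * p) → K) ≃ₗ[K] (Fin (2 * p) → K), f x = X K (2 * p) 1 ∧
      f w = X K (2 * p) (2 * p) ∧ ∀ a, Odd a → ∀ z,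
        f (μ (f.symm (X K (2 * p) a)) z) = baseBracket K p (X K (2 * p) a) (f z) := by
  obtain ⟨u, hu⟩ := exists_generators hp hμ hx hr hw hw'
  -- The indices `1` and `2 * p` are tested before parity, which would otherwise claim them; the
  -- shift `k / 2 - 1` appears because `u` is numbered from `0`.
  let c : ℕ → Fin (2 * p) → K := fun k => if k = 1 then x else if k = 2 * p then w else
    if Even k then u (k / 2 - 1) else μ x (u (k / 2 - 1))
  have hc1 : c 1 = x := by simp [c]
  have hcp : c (2 * p) = w := by
    have : ¬ 2 * p = 1 := by omega
    simp [c, this]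
  have hce : ∀ i < p - 1, c (2 * (i + 1)) = u i := by
    intro i hi
    have h1 : ¬ 2 * (i + 1) = 1 := by omega
    have h2 : ¬ 2 * (i + 1) = 2 * p := by omega
    have h3 : 2 * (i + 1) / 2 - 1 = i := by omega
    simp only [c, if_neg h1, if_neg h2, h3, if_pos (even_two_mul (i + 1))]
  have hco : ∀ i < p - 1, c (2 * (i + 1) + 1) = μ x (u i) := by
    intro i hi
    have h1 : ¬ 2 * (i + 1) + 1 = 1 := by omega
    have h2 : ¬ 2 * (i + 1) + 1 = 2 * p := by omega
    have h3 : (2 * (i + 1) + 1) / 2 - 1 = i := by omega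
    have h4 : ¬ Even (2 * (i + 1) + 1) := by simp
    simp only [c, if_neg h1, if_neg h2, h3, if_neg h4]
  let b : Fin (2 * p) → Fin (2 * p) → K := fun k => c (k.val + 1)
  have hmem : ∀ k, 1 ≤ k → k ≤ 2 * p → c k ∈ Submodule.span K (Set.range b) := by
    intro k hk hk'
    refine Submodule.subset_span ⟨⟨k - 1, by omega⟩, ?_⟩
    simp only [b, Nat.sub_add_cancel hk]
  have hspan : ⊤ ≤ Submodule.span K (Set.range b) := by
    refine (hu _ ?_ ?_ fun i hi => ⟨?_, ?_⟩).ge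
    · exact hc1 ▸ hmem 1 le_rfl (by omega)
    · exact hcp ▸ hmem (2 * p) (by omega) le_rfl
    · exact hce i hi ▸ hmem _ (by omega) (by omega)
    · exact hco i hi ▸ hmem _ (by omega) (by omega)
  let B := basisOfTopLeSpanOfCardEqFinrank b hspan (by simp)
  have hB : ∀ i, B i = c (i.val + 1) := fun i => by
    simp only [B, coe_basisOfTopLeSpanOfCardEqFinrank, b]
  have hf : ∀ k, 1 ≤ k → k ≤ 2 * p → B.equivFun (c k) = X K (2 * p) k := by
    intro k hk hk'
    have h := hB ⟨k - 1, by omega⟩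
    simp only [Nat.sub_add_cancel hk] at h
    rw [← h]
    ext j
    rw [Basis.equivFun_self]
    simp only [X, Fin.ext_iff]
    exact if_congr (by omega) rfl rfl
  refine ⟨B.equivFun, hc1 ▸ hf 1 le_rfl (by omega), ?_, ?_⟩
  · rw [← hf (2 * p) (by omega) le_rfl, hcp]
  rintro a ha z
  have hcase : ∀ k, Odd k → 1 ≤ k → k ≤ 2 * p → k = 1 ∨ ∃ i < p - 1, k = 2 * (i + 1) + 1 := by
    rintro k ⟨i, rfl⟩ _ hk
    by_cases hi : i = 0
    · left; omega
    · exact Or.inr ⟨i - 1, by omega, by omega⟩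
  -- Beyond the dimension `X a` is the zero vector, so both sides vanish.
  by_cases hap : 2 * p < a
  · simp [X_eq_zero (K := K) (Or.inr hap)]
  have ha1 : 1 ≤ a := ha.pos
  have hsymm : B.equivFun.symm (X K (2 * p) a) = c a := by
    rw [LinearEquiv.symm_apply_eq, hf a ha1 (by omega)]
  rw [hsymm]
  rcases hcase a ha ha1 (by omega) with rfl | ⟨i, hi, rfl⟩
  · rw [hc1]
    have hlin : B.equivFun.toLinearMap ∘ₗ μ x =
        baseBracket K p (X K (2 * p) 1) ∘ₗ B.equivFun.toLinearMap := by
      refine B.ext fun k => ?_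
      simp only [LinearMap.comp_apply, LinearEquiv.coe_coe, hB]
      rw [hf (k.val + 1) (by omega) (by omega)]
      rcases Nat.even_or_odd (k.val + 1) with hk | hk
      · obtain ⟨i, hi⟩ := even_iff_exists_two_mul.1 hk
        by_cases hip : i = p
        · rw [hi, hip, hcp, hw, map_zero, baseBracket_X_one_X (Or.inr rfl)]
        · obtain ⟨j, rfl⟩ : ∃ j, i = j + 1 := ⟨i - 1, by omega⟩
          have hj : j < p - 1 := by omega
          rw [hi, hce j hj, ← hco j hj, hf _ (by omega) (by omega),
            baseBracket_X_one_X_even (by omega) (by omega)]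
      · rw [baseBracket_X_one_X (Or.inl hk)]
        rcases hcase _ hk (by omega) (by omega) with h | ⟨i, hi, h⟩
        · rw [h, hc1, hμ.1, map_zero]
        · rw [h, hco i hi, apply_apply_eq_zero hμ, map_zero]
    exact LinearMap.congr_fun hlin z
  · rw [hco i hi, baseBracket_X_eq_zero (by omega) (Or.inl ha), hμ.2]
    simp

theorem exists_mem_family {p : ℕ} {μ : Bracket K (2 * p)} (h : μ ∈ family K p) :
    ∃ x, x ∉ derivedIdeal μ ∧ p - 1 ≤ finrank K (LinearMap.range (μ x)) := by
  obtain ⟨-, ⟨x, hx, hx'⟩, -⟩ := h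
  exact ⟨x, hx, by simpa using hx'.sum_pred_le_finrank_range⟩

/-- The bound on `[g, g]` forces `[g, g] = im (ad x)`, which the adapted coordinates carry into
`oddSpan`; any choice of `w` works. -/
theorem mem_component₁_iff {p : ℕ} (hp : 1 ≤ p) {μ : Bracket K (2 * p)} :
    μ ∈ component₁ K p ↔ μ ∈ family K p ∧ finrank K (derivedIdeal μ) ≤ p - 1 := by
  constructor
  · rintro ⟨φ, hφ, f, hμ⟩
    have h := isDeformation_of_mem₁ hφ
    exact ⟨h.mem_family hp le_rfl le_sup_left hμ,
      (h.finrank_derivedIdeal_le le_rfl hμ).trans (finrank_oddSpan p).le⟩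
  · rintro ⟨hF, hd⟩
    obtain ⟨x, hx, hr⟩ := exists_mem_family hF
    have hμ := hF.1
    obtain ⟨w, hw, hw'⟩ := exists_complement hp hμ hx
    obtain ⟨f, hfx, -, hf⟩ := exists_adapted_equiv hp hμ hx hr hw hw'
    have hder : LinearMap.range (μ x) = derivedIdeal μ :=
      Submodule.eq_of_le_of_finrank_le (range_le_derivedIdeal μ x) (hd.trans hr)
    have hmem : ∀ y z, f (μ y z) ∈ oddSpan K p := by
      intro y z
      have hyz : μ y z ∈ LinearMap.range (μ x) := hder ▸ apply_mem_derivedIdeal μ y z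
      obtain ⟨z', hz'⟩ := hyz
      have := hf 1 odd_one z'
      rw [← hfx, LinearEquiv.symm_apply_apply, hz'] at this
      rw [this]
      exact baseBracket_mem_oddSpan p _ _
    let ν : Bracket K (2 * p) :=
      (μ.compl₁₂ f.symm.toLinearMap f.symm.toLinearMap).compr₂ f.toLinearMap
    have hν : ∀ y z, ν y z = f (μ (f.symm y) (f.symm z)) := fun y z => rfl
    have hself : ∀ y, (ν - baseBracket K p) y y = 0 := fun y => by
      simp [hν, hμ.1, baseBracket_self]
    have hodd : ∀ a, Odd a → ∀ z, (ν - baseBracket K p) (X K (2 * p) a) z = 0 := by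
      intro a ha z
      simp [hν, hf a ha]
    refine ⟨ν - baseBracket K p, ⟨hself, ?_, ?_⟩, f, fun y z => by simp [hν]⟩
    · intro i j _ _ _
      exact sub_mem (hmem _ _) (baseBracket_mem_oddSpan p _ _)
    · rintro a b (h | h)
      · exact hodd a h _
      · rw [apply_eq_neg hself, hodd b h, neg_zero]

/-- By skew-symmetry `ker μ` is the centre. Its dimension exceeds that of `im (ad x)`, so `w` can be
chosen central, and then `φ` vanishes on `X (2 p)` as well. The bound `2 ≤ p` makes `ad x` nonzero,
so `x` is not central. -/
theorem mem_component₂_iff {p : ℕ} (hp : 2 ≤ p) {μ : Bracket K (2 * p)} :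
    μ ∈ component₂ K p ↔ μ ∈ family K p ∧ p ≤ finrank K (LinearMap.ker μ) := by
  constructor
  · rintro ⟨φ, hφ, f, hμ⟩
    have h := isDeformation_of_mem₂ hφ
    exact ⟨h.mem_family (by omega) le_sup_left le_rfl hμ,
      (finrank_oddSpanSup (by omega)).ge.trans (h.le_finrank_ker le_rfl hμ)⟩
  · rintro ⟨hF, hd⟩
    obtain ⟨x, hx, hr⟩ := exists_mem_family hF
    have hμ := hF.1
    have hxker : x ∉ LinearMap.ker μ := by
      intro h
      rw [LinearMap.mem_ker] at h
      rw [h, LinearMap.range_zero, finrank_bot] at hr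
      omega
    have hrk : LinearMap.range (μ x) ≤ LinearMap.ker μ :=
      (range_le_derivedIdeal μ x).trans (derivedIdeal_le_ker hμ)
    obtain ⟨w, hwk, hwr⟩ : ∃ w ∈ LinearMap.ker μ, w ∉ LinearMap.range (μ x) := by
      by_contra! h
      have h1 := Submodule.finrank_mono (show LinearMap.ker μ ≤ LinearMap.range (μ x) from h)
      have := finrank_range_le hμ hx
      omega
    have hw : μ x w = 0 := ker_le_ker_apply hμ x hwk
    -- A component of `w` along `x` would make `x` central, since `w` and `im (ad x)` are.
    have hw' : w ∉ LinearMap.range (μ x) ⊔ Submodule.span K {x} := by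
      intro h
      obtain ⟨r, hr', y, hy, rfl⟩ := Submodule.mem_sup.1 h
      obtain ⟨t, rfl⟩ := Submodule.mem_span_singleton.1 hy
      by_cases ht : t = 0
      · simp only [ht, zero_smul, add_zero] at hwr
        exact hwr hr'
      · refine hxker ?_
        have h1 : t • x ∈ LinearMap.ker μ := by simpa using sub_mem hwk (hrk hr')
        exact (Submodule.smul_mem_iff _ ht).1 h1
    obtain ⟨f, hfx, hfw, hf⟩ := exists_adapted_equiv (by omega) hμ hx hr hw hw'
    -- The centre omits `x`, so it is strictly smaller than `ker (ad x)`, of dimension at most `p +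
    -- 1`; the left side already has dimension at least `p`.
    have hker : LinearMap.range (μ x) ⊔ Submodule.span K {w} = LinearMap.ker μ := by
      refine Submodule.eq_of_le_of_finrank_le (sup_le hrk ?_) ?_
      · rwa [Submodule.span_singleton_le_iff_mem]
      · rw [Submodule.finrank_sup_span_singleton hwr]
        have hlt : LinearMap.ker μ < LinearMap.ker (μ x) := by
          refine lt_of_le_of_ne (ker_le_ker_apply hμ x) fun h => hxker ?_
          rw [h, LinearMap.mem_ker, hμ.1]
        have h1 := Submodule.finrank_lt_finrank_of_lt hlt
        have h2 := finrank_range_add_finrank_ker μ x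
        omega
    have hmem : ∀ y z, f (μ y z) ∈ oddSpanSup K p := by
      intro y z
      have hyz : μ y z ∈ LinearMap.range (μ x) ⊔ Submodule.span K {w} :=
        hker ▸ derivedIdeal_le_ker hμ (apply_mem_derivedIdeal μ y z)
      obtain ⟨_, ⟨z', rfl⟩, v, hv, hz'⟩ := Submodule.mem_sup.1 hyz
      obtain ⟨t, rfl⟩ := Submodule.mem_span_singleton.1 hv
      have := hf 1 odd_one z'
      rw [← hfx, LinearEquiv.symm_apply_apply] at this
      rw [← hz', map_add, map_smul, hfw, this]
      exact add_mem (Submodule.mem_sup_left (baseBracket_mem_oddSpan p _ _))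
        (Submodule.smul_mem _ _ (X_mem_oddSpanSup p))
    let ν : Bracket K (2 * p) :=
      (μ.compl₁₂ f.symm.toLinearMap f.symm.toLinearMap).compr₂ f.toLinearMap
    have hν : ∀ y z, ν y z = f (μ (f.symm y) (f.symm z)) := fun y z => rfl
    have hself : ∀ y, (ν - baseBracket K p) y y = 0 := fun y => by
      simp [hν, hμ.1, baseBracket_self]
    have hodd : ∀ a, Odd a ∨ a = 2 * p → ∀ z, (ν - baseBracket K p) (X K (2 * p) a) z = 0 := by
      rintro a (ha | rfl) z
      · simp [hν, hf a ha]
      · rw [LinearMap.sub_apply, LinearMap.sub_apply, hν, ← hfw, LinearEquiv.symm_apply_apply,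
          LinearMap.mem_ker.1 hwk, hfw, baseBracket_X_eq_zero (by omega) (Or.inr rfl)]
        simp
    refine ⟨ν - baseBracket K p, ⟨hself, ?_, ?_⟩, f, fun y z => by simp [hν]⟩
    · intro i j _ _ _
      exact sub_mem (hmem _ _) (Submodule.mem_sup_left (baseBracket_mem_oddSpan p _ _))
    · intro a b h
      by_cases ha : Odd a ∨ a = 2 * p
      · exact hodd a ha _
      · rw [apply_eq_neg hself, hodd b (by tauto), neg_zero]

end NormalForm

/-! ### Irreducibility of the orbit families through polynomial curves -/

section Irreducible

variable {K : Type*} [Field K] {n : ℕ}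

theorem exists_polynomial_of_mem_regular {g : Bracket K n → K} (hg : g ∈ regular K n)
    {γ : K → Bracket K n} {P : Fin n × Fin n × Fin n → Polynomial K}
    (hP : ∀ t i, structConst (γ t) i = (P i).eval t) :
    ∃ G : Polynomial K, ∀ t, g (γ t) = G.eval t := by
  obtain ⟨f, hf⟩ := mem_regular_iff.1 hg
  refine ⟨MvPolynomial.aeval P f, fun t => ?_⟩
  have h1 := MvPolynomial.comp_aeval_apply (R := K) (f := P) (Polynomial.aeval t) f
  rw [Polynomial.coe_aeval_eq_eval] at h1
  rw [h1, hf, funext (hP t), MvPolynomial.aeval_eq_eval]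

/-- A set of products any two points of which lie on a curve that is parametrized by polynomials
and is contained in the set up to finitely many points is preirreducible. -/
theorem isPreirreducible_of_curves [Infinite K] {C : Set (Bracket K n)}
    (hC : ∀ a ∈ C, ∀ b ∈ C, ∃ (γ : K → Bracket K n) (P : Fin n × Fin n × Fin n → Polynomial K)
      (d : Polynomial K), (∀ t i, structConst (γ t) i = (P i).eval t) ∧ γ 0 = a ∧ γ 1 = b ∧
        d.eval 0 ≠ 0 ∧ ∀ t, d.eval t ≠ 0 → γ t ∈ C) : IsPreirreducible C := by
  rintro U V hU hV ⟨a, haC, haU⟩ ⟨b, hbC, hbV⟩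
  obtain ⟨g, hg, hga, hgU⟩ := exists_regular_of_isOpen hU haU
  obtain ⟨h, hh, hhb, hhV⟩ := exists_regular_of_isOpen hV hbV
  obtain ⟨γ, P, d, hP, rfl, rfl, hd, hγ⟩ := hC a haC b hbC
  obtain ⟨G, hG⟩ := exists_polynomial_of_mem_regular hg hP
  obtain ⟨H, hH⟩ := exists_polynomial_of_mem_regular hh hP
  -- The three factors are nonzero at `0`, `1` and `0` respectively; over an infinite field their
  -- product is then nonzero at some common parameter.
  have hne : G * H * d ≠ 0 := by
    refine mul_ne_zero (mul_ne_zero ?_ ?_) ?_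
    · rintro rfl
      simp [hG] at hga
    · rintro rfl
      simp [hH] at hhb
    · rintro rfl
      simp at hd
  obtain ⟨t, ht⟩ : ∃ t, (G * H * d).eval t ≠ 0 := by
    by_contra! h
    exact hne (Polynomial.funext (by simpa using h))
  simp only [Polynomial.eval_mul, mul_ne_zero_iff] at ht
  exact ⟨γ t, hγ t ht.2, hgU _ (hG t ▸ ht.1.1), hhV _ (hH t ▸ ht.1.2)⟩

theorem isIrreducible_preimage_val {Y : Type*} [TopologicalSpace Y] {F C : Set Y} (hCF : C ⊆ F)
    (hne : C.Nonempty) (hC : IsPreirreducible C) : IsIrreducible (Subtype.val ⁻¹' C : Set F) := by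
  obtain ⟨c, hc⟩ := hne
  refine ⟨⟨⟨c, hCF hc⟩, hc⟩, ?_⟩
  rintro u v hu hv ⟨a, haC, hau⟩ ⟨b, hbC, hbv⟩
  obtain ⟨U, hU, rfl⟩ := isOpen_induced_iff.1 hu
  obtain ⟨V, hV, rfl⟩ := isOpen_induced_iff.1 hv
  obtain ⟨z, hzC, hz⟩ := hC U V hU hV ⟨a, haC, hau⟩ ⟨b, hbC, hbv⟩
  exact ⟨⟨z, hCF hzC⟩, hzC, hz⟩

theorem adjugate_toMatrix'_mulVec (f : (Fin n → K) ≃ₗ[K] (Fin n → K)) (v : Fin n → K) :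
    (LinearMap.toMatrix' f.toLinearMap).adjugate.mulVec v =
      (LinearMap.toMatrix' f.toLinearMap).det • f.symm v := by
  apply f.injective
  have h : ∀ w, f w = (LinearMap.toMatrix' f.toLinearMap).mulVec w := fun w => by
    rw [LinearMap.toMatrix'_mulVec, LinearEquiv.coe_coe]
  rw [map_smul, LinearEquiv.apply_symm_apply, h, Matrix.mulVec_mulVec, Matrix.mul_adjugate,
    Matrix.smul_mulVec, Matrix.one_mulVec]

theorem det_toMatrix'_ne_zero (f : (Fin n → K) ≃ₗ[K] (Fin n → K)) :
    (LinearMap.toMatrix' f.toLinearMap).det ≠ 0 := by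
  rw [LinearMap.det_toMatrix']
  exact f.isUnit_det'.ne_zero

/-- A nonzero scalar is absorbed by replacing `f` with `c • f`: the inverse contributes `c⁻¹` and
the two arguments contribute `c²`. -/
theorem mem_deformationOrbits_of_smul {p : ℕ} {S : Submodule K (Bracket K (2 * p))}
    {μ φ : Bracket K (2 * p)} (hφ : φ ∈ S) (f : (Fin (2 * p) → K) ≃ₗ[K] (Fin (2 * p) → K)) {c : K}
    (hc : c ≠ 0) (h : ∀ x y, μ x y = c • f.symm ((baseBracket K p + φ) (f x) (f y))) :
    μ ∈ deformationOrbits S := by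
  refine ⟨φ, hφ, f.trans (LinearEquiv.smulOfNeZero K _ c hc), fun x y => ?_⟩
  rw [LinearEquiv.eq_symm_apply]
  simp only [LinearEquiv.trans_apply, LinearEquiv.smulOfNeZero_apply, h, map_smul,
    LinearEquiv.apply_symm_apply, LinearMap.smul_apply]

/-- The product `s • adj M (ν (M x, M y))`. -/
noncomputable def adjugateTwist (s : K) (M : Matrix (Fin n) (Fin n) K) (ν : Bracket K n) :
    Bracket K n :=
  s • (ν.compl₁₂ (Matrix.toLin' M) (Matrix.toLin' M)).compr₂ (Matrix.toLin' M.adjugate)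

theorem adjugateTwist_apply (s : K) (M : Matrix (Fin n) (Fin n) K) (ν : Bracket K n)
    (x y : Fin n → K) :
    adjugateTwist s M ν x y = s • M.adjugate.mulVec (ν (M.mulVec x) (M.mulVec y)) := rfl

theorem structConst_adjugateTwist (s : K) (M : Matrix (Fin n) (Fin n) K) (ν : Bracket K n)
    (t : Fin n × Fin n × Fin n) :
    structConst (adjugateTwist s M ν) t = s * ∑ l, M.adjugate t.2.2 l *
      ∑ a, ∑ b, M a t.1 * (M b t.2.1 * structConst ν (a, b, l)) := by
  simp only [structConst, adjugateTwist_apply, Pi.smul_apply, smul_eq_mul, Matrix.mulVec,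
    dotProduct]
  congr 1
  refine Finset.sum_congr rfl fun l _ => ?_
  rw [apply_eq_sum]
  simp [structConst]

theorem structConst_adjugateTwist_eval (s : Polynomial K) (M : Matrix (Fin n) (Fin n) (Polynomial K))
    {ν : K → Bracket K n} {c : Fin n × Fin n × Fin n → Polynomial K}
    (hc : ∀ t i, structConst (ν t) i = (c i).eval t) (t : K) (i : Fin n × Fin n × Fin n) :
    structConst (adjugateTwist (s.eval t) ((Polynomial.evalRingHom t).mapMatrix M) (ν t)) i =
      (s * ∑ l, M.adjugate i.2.2 l * ∑ a, ∑ b, M a i.1 * (M b i.2.1 * c (a, b, l))).eval t := by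
  rw [structConst_adjugateTwist, ← RingHom.map_adjugate]
  simp only [Polynomial.eval_mul, Polynomial.eval_finsetSum, hc, RingHom.mapMatrix_apply,
    Matrix.map_apply, Polynomial.coe_evalRingHom]

theorem adjugateTwist_toMatrix' (s : K) (f : (Fin n → K) ≃ₗ[K] (Fin n → K)) (ν : Bracket K n)
    (x y : Fin n → K) :
    adjugateTwist s (LinearMap.toMatrix' f.toLinearMap) ν x y =
      (s * (LinearMap.toMatrix' f.toLinearMap).det) • f.symm (ν (f x) (f y)) := by
  rw [adjugateTwist_apply, adjugate_toMatrix'_mulVec, smul_smul, LinearMap.toMatrix'_mulVec,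
    LinearMap.toMatrix'_mulVec, LinearEquiv.coe_coe]

/-- Two points are joined by moving the matrix and the cocycle along straight lines. The adjugate
replaces the inverse to keep the structure constants polynomial, and the scalar it introduces is
harmless wherever it is nonzero. -/
theorem isPreirreducible_deformationOrbits [Infinite K] {p : ℕ}
    (S : Submodule K (Bracket K (2 * p))) : IsPreirreducible (deformationOrbits S) := by
  refine isPreirreducible_of_curves ?_
  rintro a ⟨φ₀, hφ₀, f₀, ha⟩ b ⟨φ₁, hφ₁, f₁, hb⟩
  set M₀ := LinearMap.toMatrix' f₀.toLinearMap with hM₀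
  set M₁ := LinearMap.toMatrix' f₁.toLinearMap with hM₁
  let M : Matrix (Fin (2 * p)) (Fin (2 * p)) (Polynomial K) :=
    Matrix.of fun i j => Polynomial.C (M₀ i j) + Polynomial.X * Polynomial.C (M₁ i j - M₀ i j)
  -- Interpolates the inverse determinants of the two matrices, so that the curve meets both given
  -- brackets exactly rather than up to scalars.
  let s : Polynomial K :=
    Polynomial.C M₀.det⁻¹ + Polynomial.X * Polynomial.C (M₁.det⁻¹ - M₀.det⁻¹)
  let ν : K → Bracket K (2 * p) := fun t => baseBracket K p + (φ₀ + t • (φ₁ - φ₀))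
  let N : K → Matrix (Fin (2 * p)) (Fin (2 * p)) K := fun t => (Polynomial.evalRingHom t).mapMatrix M
  have hN0 : N 0 = M₀ := by
    ext i j
    simp [N, M]
  have hN1 : N 1 = M₁ := by
    ext i j
    simp [N, M]
  have hdet : ∀ t, (N t).det = M.det.eval t := fun t => by
    simp only [N, ← RingHom.map_det]
    rfl
  have hν : ∀ t i, structConst (ν t) i = (Polynomial.C (structConst (baseBracket K p + φ₀) i) +
      Polynomial.X * Polynomial.C (structConst (φ₁ - φ₀) i)).eval t := by
    intro t i
    simp [ν, structConst, add_assoc]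
  refine ⟨fun t => adjugateTwist (s.eval t) (N t) (ν t), _, s * M.det,
    structConst_adjugateTwist_eval s M hν, ?_, ?_, ?_, fun t ht => ?_⟩
  · refine LinearMap.ext₂ fun x y => ?_
    have h0 : s.eval 0 = M₀.det⁻¹ := by simp [s]
    beta_reduce
    rw [hN0, h0, adjugateTwist_toMatrix', inv_mul_cancel₀ (det_toMatrix'_ne_zero f₀), one_smul, ha]
    simp [ν]
  · refine LinearMap.ext₂ fun x y => ?_
    have h1 : s.eval 1 = M₁.det⁻¹ := by simp [s]
    beta_reduce
    rw [hN1, h1, adjugateTwist_toMatrix', inv_mul_cancel₀ (det_toMatrix'_ne_zero f₁), one_smul, hb]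
    simp [ν]
  · rw [Polynomial.eval_mul, ← hdet, hN0]
    have h0 : s.eval 0 = M₀.det⁻¹ := by simp [s]
    rw [h0]
    exact mul_ne_zero (inv_ne_zero (det_toMatrix'_ne_zero f₀)) (det_toMatrix'_ne_zero f₀)
  · rw [Polynomial.eval_mul, ← hdet] at ht
    have hu : LinearMap.det (Matrix.toLin' (N t)) ≠ 0 := by
      rw [LinearMap.det_toLin']
      exact right_ne_zero_of_mul ht
    let f := LinearMap.equivOfDetNeZero (Matrix.toLin' (N t)) hu
    have hf : LinearMap.toMatrix' f.toLinearMap = N t := by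
      have : f.toLinearMap = Matrix.toLin' (N t) := by
        ext1 x
        rfl
      rw [this, LinearMap.toMatrix'_toLin']
    have hφ : φ₀ + t • (φ₁ - φ₀) ∈ S := by
      have h : φ₀ + t • (φ₁ - φ₀) = (1 - t) • φ₀ + t • φ₁ := by module
      exact h ▸ S.add_mem (S.smul_mem _ hφ₀) (S.smul_mem _ hφ₁)
    refine mem_deformationOrbits_of_smul hφ f ht fun x y => ?_
    beta_reduce
    rw [← hf, adjugateTwist_toMatrix']

theorem nonempty_deformationOrbits {p : ℕ} (S : Submodule K (Bracket K (2 * p))) :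
    (deformationOrbits S).Nonempty :=
  ⟨baseBracket K p, 0, S.zero_mem, LinearEquiv.refl K _, fun x y => by simp⟩

end Irreducible

/-! ### Semicontinuity of the derived ideal and of the centre -/

section Semicontinuity

variable {K : Type*} [Field K] {n : ℕ}

theorem isOpen_exists_le_finrank_range (r : ℕ) :
    IsOpen {μ : Bracket K n | ∃ x, r ≤ finrank K (LinearMap.range (μ x))} := by
  simp only [Set.ofPred_exists]
  exact isOpen_iUnion fun x => isOpen_le_finrank_range (fun μ => μ x)
    (fun y k => apply_mem_regular x y k) r

theorem isOpen_le_finrank_derivedIdeal (r : ℕ) :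
    IsOpen {μ : Bracket K n | r ≤ finrank K (derivedIdeal μ)} := by
  -- Its range is `[g, g]`, spanned by the brackets of basis vectors, so the rank criterion applies.
  let T : Bracket K n → (Fin n × Fin n → K) →ₗ[K] (Fin n → K) := fun μ =>
    Fintype.linearCombination K fun t => μ (Pi.single t.1 1) (Pi.single t.2 1)
  have hT : ∀ μ, derivedIdeal μ = LinearMap.range (T μ) := by
    intro μ
    rw [Fintype.range_linearCombination]
    refine le_antisymm (derivedIdeal_le fun x y => ?_) (Submodule.span_le.2 ?_)
    · refine bracket_mem_of_X μ _ (fun a b ha ha' hb hb' => Submodule.subset_span ?_) x y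
      obtain ⟨i, rfl⟩ : ∃ i : Fin n, i.val + 1 = a := ⟨⟨a - 1, by omega⟩, by simp; omega⟩
      obtain ⟨j, rfl⟩ : ∃ j : Fin n, j.val + 1 = b := ⟨⟨b - 1, by omega⟩, by simp; omega⟩
      exact ⟨(i, j), by simp [X_succ]⟩
    · rintro _ ⟨t, rfl⟩
      exact apply_mem_derivedIdeal μ _ _
  have hset : {μ : Bracket K n | r ≤ finrank K (derivedIdeal μ)} =
      {μ | r ≤ finrank K (LinearMap.range (T μ))} := by
    ext μ
    rw [Set.mem_ofPred_eq, hT μ, Set.mem_ofPred_eq]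
  rw [hset]
  refine isOpen_le_finrank_range T (fun c k => ?_) r
  have h : (fun μ => T μ c k) =
      ∑ t, c t • fun μ : Bracket K n => μ (Pi.single t.1 1) (Pi.single t.2 1) k := by
    ext μ
    simp [T, Fintype.linearCombination_apply, Finset.sum_apply]
  rw [h]
  exact sum_mem fun t _ => Subalgebra.smul_mem _ (apply_mem_regular _ _ _) _

theorem isOpen_finrank_ker_lt (r : ℕ) :
    IsOpen {μ : Bracket K n | finrank K (LinearMap.ker μ) < r} := by
  -- Records all coordinates of the brackets of a vector with the basis, so that its kernel is `ker
  -- μ`.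
  let T : Bracket K n → (Fin n → K) →ₗ[K] (Fin n × Fin n → K) := fun μ =>
    LinearMap.pi fun t => LinearMap.proj t.2 ∘ₗ μ.flip (Pi.single t.1 1)
  have hT : ∀ μ, LinearMap.ker μ = LinearMap.ker (T μ) := by
    intro μ
    ext x
    simp only [LinearMap.mem_ker]
    constructor
    · intro h
      ext t
      simp [T, h]
    · intro h
      refine linearMap_ext_X fun a ha ha' => ?_
      obtain ⟨i, rfl⟩ : ∃ i : Fin n, i.val + 1 = a := ⟨⟨a - 1, by omega⟩, by simp; omega⟩
      ext k
      rw [X_succ]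
      exact congrFun h (i, k)
  have hset : {μ : Bracket K n | finrank K (LinearMap.ker μ) < r} =
      {μ | n + 1 - r ≤ finrank K (LinearMap.range (T μ))} ∩ {_μ | 0 < r} := by
    ext μ
    have := LinearMap.finrank_range_add_finrank_ker (T μ)
    rw [finrank_fin_fun, ← hT μ] at this
    simp only [Set.mem_ofPred_eq, Set.mem_inter_iff]
    omega
  rw [hset]
  exact (isOpen_le_finrank_range T (fun x t => apply_mem_regular x _ t.2) _).inter isOpen_const

end Semicontinuity

/-! ### The decomposition, separating examples, and small dimensions -/

section Components

variable {K : Type*} [Field K]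

theorem family_eq_union {p : ℕ} (hp : 2 ≤ p) :
    family K p = component₁ K p ∪ component₂ K p := by
  ext μ
  rw [Set.mem_union, mem_component₁_iff (by omega), mem_component₂_iff hp, ← and_or_left,
    iff_self_and]
  intro hF
  have h := Submodule.finrank_mono (derivedIdeal_le_ker hF.1)
  omega

theorem elementary_apply (n a b : ℕ) (v x y : Fin n → K) : elementary K n a b v x y =
    ((X K n a ⬝ᵥ x) * (X K n b ⬝ᵥ y) - (X K n b ⬝ᵥ x) * (X K n a ⬝ᵥ y)) • v := rfl

theorem elementary_self (n a b : ℕ) (v x : Fin n → K) : elementary K n a b v x x = 0 := by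
  rw [elementary_apply, mul_comm (X K n a ⬝ᵥ x), sub_self, zero_smul]

theorem elementary_X_left {n a b c : ℕ} (v y : Fin n → K) (h : a ≠ c) (h' : b ≠ c) :
    elementary K n a b v (X K n c) y = 0 := by
  simp [elementary_apply, X_dotProduct_X, h, h']

theorem elementary_X_right {n a b c : ℕ} (v x : Fin n → K) (h : a ≠ c) (h' : b ≠ c) :
    elementary K n a b v x (X K n c) = 0 := by
  simp [elementary_apply, X_dotProduct_X, h, h']

theorem mem_deformationOrbits_base_add {p : ℕ} {S : Submodule K (Bracket K (2 * p))}
    {φ : Bracket K (2 * p)} (h : φ ∈ S) : baseBracket K p + φ ∈ deformationOrbits S :=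
  ⟨φ, h, LinearEquiv.refl K _, fun _ _ => rfl⟩

theorem X_dotProduct_baseBracket {p i : ℕ} (hi : 1 ≤ i) (hi' : i ≤ p - 1)
    (x y : Fin (2 * p) → K) : X K (2 * p) (2 * i + 1) ⬝ᵥ baseBracket K p x y =
      (X K (2 * p) 1 ⬝ᵥ x) * (X K (2 * p) (2 * i) ⬝ᵥ y) -
        (X K (2 * p) (2 * i) ⬝ᵥ x) * (X K (2 * p) 1 ⬝ᵥ y) := by
  rw [baseBracket_apply, dotProduct_sum, Finset.sum_eq_single i]
  · have h : 2 * i + 1 ≤ 2 * p := by omega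
    simp [dotProduct_smul, X_dotProduct_X, h]
  · intro j _ hj
    simp [dotProduct_smul, X_dotProduct_X, hj.symm]
  · intro h
    exact absurd (Finset.mem_Icc.2 ⟨hi, hi'⟩) h

theorem mem_oddSpan_of_dotProduct_eq_zero {p : ℕ} {z : Fin (2 * p) → K}
    (h1 : X K (2 * p) 1 ⬝ᵥ z = 0) (h2 : ∀ i, 1 ≤ i → i ≤ p → X K (2 * p) (2 * i) ⬝ᵥ z = 0) :
    z ∈ oddSpan K p := by
  rw [eq_sum_smul_single z]
  refine sum_mem fun i _ => ?_
  have hz : z i = X K (2 * p) (i.val + 1) ⬝ᵥ z := by rw [X_succ, single_one_dotProduct]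
  rw [hz, ← X_succ]
  rcases Nat.even_or_odd (i.val + 1) with h | ⟨k, hk⟩
  · obtain ⟨k, hk⟩ := even_iff_exists_two_mul.1 h
    rw [hk, h2 k (by omega) (by omega), zero_smul]
    exact zero_mem _
  · rw [hk]
    by_cases hk0 : k = 0
    · rw [hk0, mul_zero, zero_add, h1, zero_smul]
      exact zero_mem _
    · exact Submodule.smul_mem _ _ (X_odd_mem_oddSpan (by omega) (by omega))

/-- Adding `[X 2, X (2 p)] = X 5` shrinks the centre to `oddSpan`, of dimension `p - 1`. Bracketing
a central vector with `X 1` removes its coordinates at `X 2, …, X (2 p - 2)`; bracketing with `X 2`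
removes those at `X 1` and `X (2 p)`, read off from `X 3` and `X 5`. These are two different targets
because `p ≥ 3`. -/
theorem not_component₁_subset {p : ℕ} (hp : 3 ≤ p) : ¬ component₁ K p ⊆ component₂ K p := by
  intro hsub
  let φ : Bracket K (2 * p) := elementary K (2 * p) 2 (2 * p) (X K (2 * p) (2 * 2 + 1))
  have hφ : φ ∈ cocycleFamily₁ K p := by
    refine ⟨elementary_self _ _ _ _, fun i j _ _ _ => ?_, ?_⟩
    · rw [elementary_apply]
      exact Submodule.smul_mem _ _ (X_odd_mem_oddSpan (by omega) (by omega))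
    · rintro a b (⟨k, rfl⟩ | ⟨k, rfl⟩)
      · exact elementary_X_left _ _ (by omega) (by omega)
      · exact elementary_X_right _ _ (by omega) (by omega)
  have h := ((mem_component₂_iff (by omega)).1 (hsub (mem_deformationOrbits_base_add hφ))).2
  have hle : LinearMap.ker (baseBracket K p + φ) ≤ oddSpan K p := by
    intro z hz
    have hz0 : ∀ y, baseBracket K p z y + φ z y = 0 := fun y => LinearMap.congr_fun hz y
    have hdot : ∀ i, 1 ≤ i → i ≤ p - 1 → ∀ y, (X K (2 * p) 1 ⬝ᵥ z) * (X K (2 * p) (2 * i) ⬝ᵥ y) -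
        (X K (2 * p) (2 * i) ⬝ᵥ z) * (X K (2 * p) 1 ⬝ᵥ y) +
        X K (2 * p) (2 * i + 1) ⬝ᵥ φ z y = 0 := by
      intro i hi hi' y
      rw [← X_dotProduct_baseBracket hi hi', ← dotProduct_add, hz0, dotProduct_zero]
    have heven : ∀ i, 1 ≤ i → i ≤ p - 1 → X K (2 * p) (2 * i) ⬝ᵥ z = 0 := by
      intro i hi hi'
      have h1 := hdot i hi hi' (X K (2 * p) 1)
      have h2 : φ z (X K (2 * p) 1) = 0 := elementary_X_right _ _ (by omega) (by omega)
      have h3 : ¬ 2 * i = 1 := by omega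
      have h4 : 1 ≤ 2 * p := by omega
      simpa [h2, X_dotProduct_X, h3, h4] using h1
    have h2p : ¬ 2 * p = 2 := by omega
    have h2p' : 2 ≤ 2 * p := by omega
    have h5p : 5 ≤ 2 * p := by omega
    have hφ2 : φ z (X K (2 * p) 2) = -(X K (2 * p) (2 * p) ⬝ᵥ z) • X K (2 * p) (2 * 2 + 1) := by
      simp [φ, elementary_apply, X_dotProduct_X, h2p, h2p']
    have h1 : X K (2 * p) 1 ⬝ᵥ z = 0 := by
      have := hdot 1 le_rfl (by omega) (X K (2 * p) 2)
      rw [hφ2] at this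
      simpa [X_dotProduct_X, h2p'] using this
    have hlast : X K (2 * p) (2 * p) ⬝ᵥ z = 0 := by
      have := hdot 2 (by omega) (by omega) (X K (2 * p) 2)
      rw [hφ2] at this
      simpa [X_dotProduct_X, h5p] using this
    refine mem_oddSpan_of_dotProduct_eq_zero h1 fun i hi hi' => ?_
    by_cases hip : i = p
    · rw [hip, hlast]
    · exact heven i hi (by omega)
  have := Submodule.finrank_mono hle
  rw [finrank_oddSpan] at this
  omega

/-- Adding `[X 2, X 4] = X (2 p)` enlarges `[g, g]` to dimension at least `p`; the second family
allows this because `4 ≤ 2 * (p - 1)`. -/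
theorem not_component₂_subset {p : ℕ} (hp : 3 ≤ p) : ¬ component₂ K p ⊆ component₁ K p := by
  intro hsub
  let φ : Bracket K (2 * p) := elementary K (2 * p) 2 4 (X K (2 * p) (2 * p))
  have hφ : φ ∈ cocycleFamily₂ K p := by
    refine ⟨elementary_self _ _ _ _, fun i j _ _ _ => ?_, ?_⟩
    · rw [elementary_apply]
      exact Submodule.smul_mem _ _ (X_mem_oddSpanSup p)
    · rintro a b (⟨k, rfl⟩ | ⟨k, rfl⟩ | rfl | rfl)
      · exact elementary_X_left _ _ (by omega) (by omega)
      · exact elementary_X_right _ _ (by omega) (by omega)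
      · exact elementary_X_left _ _ (by omega) (by omega)
      · exact elementary_X_right _ _ (by omega) (by omega)
  have h := ((mem_component₁_iff (by omega)).1 (hsub (mem_deformationOrbits_base_add hφ))).2
  have hle : oddSpanSup K p ≤ derivedIdeal (baseBracket K p + φ) := by
    refine sup_le (Submodule.span_le.2 ?_) ?_
    · rintro _ ⟨k, hk, hk', rfl⟩
      refine Submodule.subset_span ⟨X K (2 * p) 1, X K (2 * p) (2 * k), ?_⟩
      have : φ (X K (2 * p) 1) (X K (2 * p) (2 * k)) = 0 :=
        elementary_X_left _ _ (by omega) (by omega)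
      rw [LinearMap.add_apply, LinearMap.add_apply, baseBracket_X_one_X_even hk hk', this, add_zero]
    · rw [Submodule.span_singleton_le_iff_mem]
      refine Submodule.subset_span ⟨X K (2 * p) 2, X K (2 * p) 4, ?_⟩
      have h2 : 2 ≤ 2 * p := by omega
      have h4 : 4 ≤ 2 * p := by omega
      have : φ (X K (2 * p) 2) (X K (2 * p) 4) = X K (2 * p) (2 * p) := by
        simp [φ, elementary_apply, X_dotProduct_X, h2, h4]
      rw [LinearMap.add_apply, LinearMap.add_apply, baseBracket_X_X (by omega) (by omega), this,
        zero_add]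
  have := Submodule.finrank_mono hle
  rw [finrank_oddSpanSup (by omega)] at this
  omega

theorem cocycleFamily₂_le {p : ℕ} (hp : p ≤ 2) : cocycleFamily₂ K p ≤ cocycleFamily₁ K p := by
  rintro φ ⟨h1, -, h3⟩
  refine ⟨h1, fun i j hi hij hj => ?_, fun a b h => h3 a b (by tauto)⟩
  obtain rfl : j = p := by omega
  rw [h3 _ _ (by tauto)]
  exact zero_mem _

theorem cocycleFamily₁_le_of_eq_one : cocycleFamily₁ K 1 ≤ cocycleFamily₂ K 1 := by
  rintro φ ⟨h1, -, h3⟩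
  have hφ : φ = 0 := by
    refine linearMap_ext_X fun a ha ha' => linearMap_ext_X fun b hb hb' => ?_
    rcases Nat.even_or_odd a with hae | ha
    · rcases Nat.even_or_odd b with hbe | hb
      · obtain ⟨i, rfl⟩ := hae
        obtain ⟨j, rfl⟩ := hbe
        obtain rfl : i = j := by omega
        simp [h1]
      · simp [h3 a b (Or.inr hb)]
    · simp [h3 a b (Or.inl ha)]
  rw [hφ]
  exact zero_mem _

/-- The only parameter is `c` in `[X 2, X 4] = c X 3`. The vector `X 4 + c X 1` is central, as its
two brackets with `X 2` cancel; with `X 3` it gives a centre of dimension at least `2`. -/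
theorem component₁_two_subset : component₁ K 2 ⊆ component₂ K 2 := by
  intro μ hμ
  refine (mem_component₂_iff le_rfl).2 ⟨((mem_component₁_iff (by omega)).1 hμ).1, ?_⟩
  obtain ⟨φ, hφ, f, hf⟩ := hμ
  have hdef := isDeformation_of_mem₁ hφ
  obtain ⟨c, hc⟩ : ∃ c : K, c • X K (2 * 2) 3 = φ (X K (2 * 2) 2) (X K (2 * 2) 4) := by
    have hle : oddSpan K 2 ≤ Submodule.span K {X K (2 * 2) 3} := by
      refine Submodule.span_le.2 ?_
      rintro _ ⟨k, hk, hk', rfl⟩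
      obtain rfl : k = 1 := by omega
      exact Submodule.mem_span_singleton_self _
    exact Submodule.mem_span_singleton.1 (hle (hdef.mem _ _))
  set v := X K (2 * 2) 4 + c • X K (2 * 2) 1 with hv
  have hvker : (baseBracket K 2 + φ) v = 0 := by
    have h4 : baseBracket K 2 (X K (2 * 2) 4) = 0 :=
      baseBracket_X_eq_zero (by omega) (Or.inr rfl)
    have hv' : (baseBracket K 2 + φ) v = φ (X K (2 * 2) 4) + c • baseBracket K 2 (X K (2 * 2) 1) := by
      rw [hv, map_add, map_smul, LinearMap.add_apply, LinearMap.add_apply, h4, hdef.X_one,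
        zero_add, add_zero]
    rw [hv']
    refine linearMap_ext_X fun b hb hb' => ?_
    simp only [LinearMap.add_apply, LinearMap.smul_apply, LinearMap.zero_apply]
    have hb4 : b = 1 ∨ b = 2 ∨ b = 3 ∨ b = 4 := by omega
    have ho : ∀ a, Odd a → φ (X K (2 * 2) 4) (X K (2 * 2) a) = 0 := fun a ha =>
      hφ.2.2 4 a (Or.inr ha)
    rcases hb4 with rfl | rfl | rfl | rfl
    · rw [baseBracket_self, ho 1 odd_one, smul_zero, add_zero]
    · have := baseBracket_X_one_X_even (K := K) (p := 2) (i := 1) le_rfl le_rfl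
      rw [apply_eq_neg hdef.self, ← hc]
      simp only [mul_one] at this
      rw [this, neg_add_cancel]
    · rw [baseBracket_X_one_X (b := 3) (Or.inl ⟨1, rfl⟩), ho 3 ⟨1, rfl⟩, smul_zero, add_zero]
    · rw [baseBracket_X_one_X (b := 4) (Or.inr rfl), hdef.self, smul_zero, add_zero]
  have hvodd : v ∉ oddSpan K 2 := by
    intro h
    have key : oddSpan K 2 ≤ LinearMap.ker (LinearMap.proj (R := K) (3 : Fin (2 * 2))) := by
      refine Submodule.span_le.2 ?_
      rintro _ ⟨k, hk, hk', rfl⟩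
      obtain rfl : k = 1 := by omega
      simp [X]
    have := key h
    simp [hv, X] at this
  have hle : (oddSpan K 2 ⊔ Submodule.span K {v}).map f.symm.toLinearMap ≤ LinearMap.ker μ := by
    rw [Submodule.map_le_iff_le_comap]
    have hz : ∀ z, (baseBracket K 2 + φ) z = 0 → μ (f.symm z) = 0 := by
      intro z hz
      refine LinearMap.ext fun y => ?_
      rw [hf, LinearEquiv.apply_symm_apply, hz]
      simp
    refine sup_le (fun z hzS => hz z ?_) ?_
    · rw [LinearMap.add_apply, hdef.eq_zero z hzS,
        baseBracket_oddSpanSup (Submodule.mem_sup_left hzS), add_zero]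
    · rw [Submodule.span_singleton_le_iff_mem]
      exact hz v hvker
  have := Submodule.finrank_mono hle
  rwa [LinearEquiv.finrank_map_eq, Submodule.finrank_sup_span_singleton hvodd,
    finrank_oddSpan] at this

theorem deformationOrbits_mono {p : ℕ} {S T : Submodule K (Bracket K (2 * p))} (h : S ≤ T) :
    deformationOrbits S ⊆ deformationOrbits T := by
  rintro μ ⟨φ, hφ, hμ⟩
  exact ⟨φ, h hφ, hμ⟩

theorem component₁_eq_component₂ {p : ℕ} (hp : 1 ≤ p) (hp' : p ≤ 2) :
    component₁ K p = component₂ K p := by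
  refine Set.Subset.antisymm ?_ (deformationOrbits_mono (cocycleFamily₂_le hp'))
  rcases (show p = 1 ∨ p = 2 by omega) with rfl | rfl
  · exact deformationOrbits_mono cocycleFamily₁_le_of_eq_one
  · exact component₁_two_subset

/-- For `p = 1` the rank bound gives `ad x = 0` outside `[g, g]`, while elements of `[g, g]` are
central. -/
theorem derivedIdeal_eq_bot {μ : Bracket K (2 * 1)} (hμ : μ ∈ twoNilp K (2 * 1)) :
    derivedIdeal μ = ⊥ := by
  refine le_bot_iff.1 (derivedIdeal_le fun x y => ?_)
  by_cases hx : x ∈ derivedIdeal μ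
  · rw [LinearMap.mem_ker.1 (derivedIdeal_le_ker hμ hx)]
    simp
  · have h := Submodule.finrank_eq_zero.1 (Nat.le_zero.1 (finrank_range_le hμ hx))
    exact h ▸ LinearMap.mem_range_self (μ x) y

theorem family_eq {p : ℕ} (hp : 1 ≤ p) : family K p = component₁ K p ∪ component₂ K p := by
  rcases hp.eq_or_lt with rfl | hp
  · rw [component₁_eq_component₂ le_rfl one_le_two |>.symm, Set.union_self]
    ext μ
    rw [mem_component₁_iff le_rfl, iff_self_and]
    intro h
    rw [derivedIdeal_eq_bot h.1, finrank_bot]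
  · exact family_eq_union hp

theorem isClosed_component₁ {p : ℕ} (hp : 1 ≤ p) :
    IsClosed (Subtype.val ⁻¹' component₁ K p : Set (family K p)) := by
  refine ⟨?_⟩
  have h := (isOpen_le_finrank_derivedIdeal (K := K) (n := 2 * p) p).preimage
    (continuous_subtype_val (p := (· ∈ family K p)))
  convert h using 1
  ext ⟨μ, hμ⟩
  simp only [Set.mem_compl_iff, Set.mem_preimage, mem_component₁_iff hp, hμ, true_and,
    Set.mem_ofPred_eq]
  omega

theorem isClosed_component₂ {p : ℕ} (hp : 1 ≤ p) :
    IsClosed (Subtype.val ⁻¹' component₂ K p : Set (family K p)) := by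
  rcases hp.eq_or_lt with rfl | hp
  · rw [← component₁_eq_component₂ le_rfl one_le_two]
    exact isClosed_component₁ le_rfl
  refine ⟨?_⟩
  have h := (isOpen_finrank_ker_lt (K := K) (n := 2 * p) p).preimage
    (continuous_subtype_val (p := (· ∈ family K p)))
  convert h using 1
  ext ⟨μ, hμ⟩
  simp only [Set.mem_compl_iff, Set.mem_preimage, mem_component₂_iff hp, hμ, true_and,
    Set.mem_ofPred_eq, not_le]

theorem isOpen_family {p : ℕ} (hp : 1 ≤ p) :
    IsOpen (Subtype.val ⁻¹' family K p : Set (twoNilp K (2 * p))) := by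
  have h := (isOpen_exists_le_finrank_range (K := K) (n := 2 * p) (p - 1)).preimage
    (continuous_subtype_val (p := (· ∈ twoNilp K (2 * p))))
  convert h using 1
  ext ⟨μ, hμ⟩
  simp only [Set.mem_preimage, mem_family_iff hp, hμ, true_and, Set.mem_ofPred_eq]

theorem component₁_ne_iff {p : ℕ} (hp : 1 ≤ p) : component₁ K p ≠ component₂ K p ↔ 3 ≤ p := by
  constructor
  · intro h
    by_contra! hp'
    exact h (component₁_eq_component₂ hp (by omega))
  · intro h he
    exact not_component₁_subset h (le_of_eq he)

theorem irreducibleComponents_family [Infinite K] {p : ℕ} (hp : 1 ≤ p) :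
    irreducibleComponents (family K p) =
      {Subtype.val ⁻¹' component₁ K p, Subtype.val ⁻¹' component₂ K p} := by
  have hsub₁ : component₁ K p ⊆ family K p := family_eq (K := K) hp ▸ Set.subset_union_left
  have hsub₂ : component₂ K p ⊆ family K p := family_eq (K := K) hp ▸ Set.subset_union_right
  refine irreducibleComponents_eq_pair
    (isIrreducible_preimage_val hsub₁ (nonempty_deformationOrbits _)
      (isPreirreducible_deformationOrbits _))
    (isIrreducible_preimage_val hsub₂ (nonempty_deformationOrbits _)
      (isPreirreducible_deformationOrbits _))
    (isClosed_component₁ hp) (isClosed_component₂ hp) ?_ (fun h => ?_) (fun h => ?_)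
  · rw [← Set.preimage_union, ← family_eq hp, Subtype.coe_preimage_self]
  · have h' : component₁ K p ⊆ component₂ K p := fun μ hμ => h (a := ⟨μ, hsub₁ hμ⟩) hμ
    by_cases hp3 : 3 ≤ p
    · exact absurd h' (not_component₁_subset hp3)
    · rw [component₁_eq_component₂ hp (by omega)]
  · have h' : component₂ K p ⊆ component₁ K p := fun μ hμ => h (a := ⟨μ, hsub₂ hμ⟩) hμ
    by_cases hp3 : 3 ≤ p
    · exact absurd h' (not_component₂_subset hp3)
    · rw [component₁_eq_component₂ hp (by omega)]

end Components

end TwoNilpotent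

theorem mainTheorem8 {K : Type*} [Field K] [IsAlgClosed K] [CharZero K] (p : ℕ) (hp : 1 ≤ p) :
    -- both linear families consist of cocycles of the algebra that is deformed
    (∀ φ ∈ TwoNilpotent.cocycleFamily₁ K p,
      φ ∈ TwoNilpotent.cocycles (TwoNilpotent.baseBracket K p)) ∧
    (∀ φ ∈ TwoNilpotent.cocycleFamily₂ K p,
      φ ∈ TwoNilpotent.cocycles (TwoNilpotent.baseBracket K p)) ∧
    -- the family is a variety: a Zariski-open part of the variety of 2-step nilpotent algebras
    IsOpen (Subtype.val ⁻¹' TwoNilpotent.family K p :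
      Set (TwoNilpotent.twoNilp K (2 * p))) ∧
    -- it is the union of the two pieces, which are its irreducible components
    TwoNilpotent.family K p = TwoNilpotent.component₁ K p ∪ TwoNilpotent.component₂ K p ∧
    irreducibleComponents (TwoNilpotent.family K p) =
      {Subtype.val ⁻¹' TwoNilpotent.component₁ K p,
        Subtype.val ⁻¹' TwoNilpotent.component₂ K p} ∧
    -- and these are two different components, except in dimensions 2 and 4
    (TwoNilpotent.component₁ K p ≠ TwoNilpotent.component₂ K p ↔ 3 ≤ p) := by
  have : Infinite K := CharZero.infinite K
  exact ⟨fun φ hφ => (TwoNilpotent.isDeformation_of_mem₁ hφ).mem_cocycles le_rfl le_sup_left,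
    fun φ hφ => (TwoNilpotent.isDeformation_of_mem₂ hφ).mem_cocycles le_sup_left le_rfl,
    TwoNilpotent.isOpen_family hp, TwoNilpotent.family_eq hp,
    TwoNilpotent.irreducibleComponents_family hp, TwoNilpotent.component₁_ne_iff hp⟩
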